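/- **Dieudonné's Lemma of the $n$-th order.** Write $\mathbb D$ for the open unit disk, $\overline{\mathbb D}(c,\rho)=\{\zeta:|\zeta-c|\le\rho\}$, $T_a(z)=\dfrac{z+a}{1+\bar a z}$, let $\mathcal H_0$ be the class of analytic $h:\mathbb D\to\mathbb D$ with $h(0)=0$, and $\mathcal S$ the class of analytic functions $\mathbb D\to\overline{\mathbb D}$. *Notation.* Define $F_1=\gamma_1$, $F_2=(1-|\gamma_1|^2)\gamma_2$ and, for $m\ge 3$, $$F_m(\gamma_1,\dots,\gamma_m)=(1-|\gamma_1|^2)F_{m-1}(\gamma_2,\dots,\gamma_m)-\bar\gamma_1\sum_{k=2}^{m-1}F_{m-k}(\gamma_2,\dots,\gamma_{m-k+1})F_k(\gamma_1,\dots,\gamma_k),$$ and $G_m(\gamma_1,\dots,\gamma_{m-1})=F_m(\gamma_1,\dots,\gamma_m)-(1-|\gamma_1|^2)\cdots(1-|\gamma_{m-1}|^2)\gamma_m$, which does not depend on $\gamma_m$ (in particular $G_1=0$). Let $$A_{m,k}(x_1,\dots,x_{m-k+1})=\sum\frac{m!}{j_1!\cdots j_{m-k+1}!}\prod_{i=1}^{m-k+1}\Big(\frac{x_i}{i!}\Big)^{j_i}$$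 (sum over all $j_i\ge 0$ with $\sum_i j_i=k$, $\sum_i i\,j_i=m$) be the partial Bell polynomials, and $\alpha_{m,k}=(-1)^{m-k}\dfrac{m!(m-1)!}{k!(k-1)!(m-k)!}$ for $1\le k\le m$. For $z_0,\gamma_0\in\mathbb D$ and $\gamma_1,\gamma_2,\ldots\in\overline{\mathbb D}$ set $c_0=0$, and for $m\ge 0$ $$\rho_m=\frac{m!\prod_{k=0}^{m-1}(1-|\gamma_k|^2)}{(1-|z_0|^2)^m},$$ and recursively for $m\ge1$ $$c_m=\frac{1-|\gamma_0|^2}{(1-|z_0|^2)^m}\big[m!\,G_m(\gamma_1,\dots,\gamma_{m-1})-s_{m-1}\big],$$ $$s_{m-1}=\sum_{k=1}^{m-1}\alpha_{m,k}\frac{\bar z_0^{\,m-k}(1-|z_0|^2)^k(c_k+\rho_k\gamma_k)}{1-|\gamma_0|^2}-\sum_{k=2}^m k!(-\bar\gamma_0)^{k-1}A_{m,k}\big(1!F_1,\,2!F_2,\,\dots,\,(m-k+1)!F_{m-k+1}\big),$$ where $F_i=F_i(\gamma_1,\dots,\gamma_i)$. Finally put $$c'_m=m\,c_{m-1}+m\,\rho_{m-1}\gamma_{m-1}+z_0c_m,\qquad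 \rho'_m=|z_0|\rho_m\qquad(m\ge 1);$$ thus $c'_m$ and $\rho'_m$ depend only on $z_0,\gamma_0,\dots,\gamma_{m-1}$, and $c'_1=\gamma_0$. *Theorem.* Let $n\ge 1$, let $z_0,w_0\in\mathbb D$ with $|w_0|<|z_0|$, put $\gamma_0=w_0/z_0$, let $\gamma_1,\dots,\gamma_{n-1}\in\overline{\mathbb D}$, and put $w_k=c'_k+\rho'_k\,z_0\gamma_k/|z_0|$ for $1\le k\le n-1$. Let $\mathcal H_0(z_0,w_0,\dots,w_{n-1})$ be the class of all $h\in\mathcal H_0$ with $h^{(k)}(z_0)=w_k$ for $0\le k\le n-1$. 1. Suppose that for some $1\le j\le n-1$ we have $|\gamma_1|<1,\dots,|\gamma_{j-1}|<1$, $|\gamma_j|=1$ and $\gamma_{j+1}=\cdots=\gamma_{n-1}=0$. Then every $h\in\mathcal H_0(z_0,w_0,\dots,w_{n-1})$ satisfies $h^{(n)}(z_0)=c'_n$ and $$h(z)=z\,T_{\gamma_0}\big(T_{-z_0}(z)T_{\gamma_1}(\cdots T_{-z_0}(z)T_{\gamma_{j-1}}(\gamma_jT_{-z_0}(z))\cdots)\big)\qquad(z\in\mathbb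 D),$$ and the factor multiplying $z$ here is a Blaschke product of degree $j$, i.e. of the form $e^{i\theta}\prod_{i=1}^{j}\dfrac{z-a_i}{1-\bar a_iz}$ with $\theta\in\mathbb R$, $a_i\in\mathbb D$. 2. Suppose that $|\gamma_1|<1,\dots,|\gamma_{n-1}|<1$. For $\varepsilon\in\overline{\mathbb D}$ let $$f_{\gamma,\varepsilon}(z)=T_{\gamma_0}\big(T_{-z_0}(z)T_{\gamma_1}(\cdots T_{-z_0}(z)T_{\gamma_{n-1}}(\varepsilon T_{-z_0}(z))\cdots)\big),\qquad h_{\gamma,\varepsilon}(z)=z f_{\gamma,\varepsilon}(z).$$ Then $h_{\gamma,\varepsilon}\in\mathcal H_0(z_0,w_0,\dots,w_{n-1})$ for all $\varepsilon\in\overline{\mathbb D}$, and $$\{h^{(n)}(z_0):h\in\mathcal H_0(z_0,w_0,\dots,w_{n-1})\}=\overline{\mathbb D}(c'_n,\rho'_n)=\{h_{\gamma,\varepsilon}^{(n)}(z_0):\varepsilon\in\overline{\mathbb D}\}.$$ Every $h\in\mathcal H_0(z_0,w_0,\dots,w_{n-1})$ has the form $$h(z)=z\,T_{\gamma_0}\big(T_{-z_0}(z)T_{\gamma_1}(\cdots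 T_{-z_0}(z)T_{\gamma_{n-1}}(T_{-z_0}(z)h^*(z))\cdots)\big)\qquad(z\in\mathbb D)$$ with some $h^*\in\mathcal S$; and $h^{(n)}(z_0)\in\partial\overline{\mathbb D}(c'_n,\rho'_n)$ if and only if $h=h_{\gamma,\varepsilon}$ on $\mathbb D$ for some constant $\varepsilon$ with $|\varepsilon|=1$. -/

import Mathlib

open scoped ComplexConjugate

namespace Dieudonne

noncomputable section

/-- The disk automorphism `T_a(z) = (z + a) / (1 + conj a * z)`. -/
def diskT (a z : ℂ) : ℂ := (z + a) / (1 + conj a * z)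

/-- The class `𝓢` of analytic functions from the open unit disk to the closed unit disk. -/
def SchurClass : Set (ℂ → ℂ) :=
  {f | DifferentiableOn ℂ f (Metric.ball 0 1) ∧
    Set.MapsTo f (Metric.ball 0 1) (Metric.closedBall 0 1)}

/-- The class `𝓗₀` of analytic self-maps of the open unit disk that fix the origin. -/
def selfMapsFixingZero : Set (ℂ → ℂ) :=
  {h | DifferentiableOn ℂ h (Metric.ball 0 1) ∧
    Set.MapsTo h (Metric.ball 0 1) (Metric.ball 0 1) ∧ h 0 = 0}

/-- The class `𝓗₀(z₀, w₀, …, w_{n-1})` of all `h ∈ 𝓗₀` with `h^(k)(z₀) = w_k` for `k < n`. -/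
def interpClass (n : ℕ) (z₀ : ℂ) (w : ℕ → ℂ) : Set (ℂ → ℂ) :=
  {h | h ∈ selfMapsFixingZero ∧ ∀ k < n, iteratedDeriv k h z₀ = w k}

/-- `B` is (on the unit disk) a Blaschke product of degree `d`:
`B z = exp (iθ) ∏ (z - a_i) / (1 - conj a_i * z)` with `d` points `a_i` of the disk. -/
def IsBlaschkeProduct (d : ℕ) (B : ℂ → ℂ) : Prop :=
  ∃ (θ : ℝ) (a : Fin d → ℂ), (∀ i, ‖a i‖ < 1) ∧
    ∀ z : ℂ, ‖z‖ < 1 →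
      B z = Complex.exp (θ * Complex.I) * ∏ i, (z - a i) / (1 - conj (a i) * z)

/-- The nested function
`T_{γ₀}(T_{-z₀}(z) T_{γ₁}(⋯ T_{-z₀}(z) T_{γ_{m-1}}(T_{-z₀}(z) g(z)) ⋯ ))` with `m` factors
`T_{γ₀}, …, T_{γ_{m-1}}`. -/
def nest (z₀ : ℂ) : ℕ → (ℕ → ℂ) → (ℂ → ℂ) → ℂ → ℂ
  | 0, _, g, z => g z
  | m + 1, γ, g, z => diskT (γ 0) (diskT (-z₀) z * nest z₀ m (fun i => γ (i + 1)) g z)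

/-- The function `h_{γ,ε}(z) = z f_{γ,ε}(z)`, where
`f_{γ,ε}(z) = T_{γ₀}(T_{-z₀}(z) T_{γ₁}(⋯ T_{-z₀}(z) T_{γ_{n-1}}(ε T_{-z₀}(z)) ⋯ ))`. -/
def extremal (n : ℕ) (z₀ : ℂ) (γ : ℕ → ℂ) (ε : ℂ) (z : ℂ) : ℂ :=
  z * nest z₀ n γ (fun _ => ε) z

/-- The polynomials `F_n(γ₁, …, γ_n)`; here `γ` is a sequence of which only the entries with
indices `1, …, n` are used. They are defined by `F₁ = γ₁`, `F₂ = (1 - |γ₁|²) γ₂` and, for `n ≥ 3`,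
`F_n(γ₁, …, γ_n) = (1 - |γ₁|²) F_{n-1}(γ₂, …, γ_n)
  - conj γ₁ ∑_{k=2}^{n-1} F_{n-k}(γ₂, …, γ_{n-k+1}) F_k(γ₁, …, γ_k)`
(below `n` is written `m + 3` and `k` is written `i + 2`). -/
def schurF : ℕ → (ℕ → ℂ) → ℂ
  | 0, _ => 0
  | 1, γ => γ 1
  | 2, γ => (1 - (‖γ 1‖ : ℂ) ^ 2) * γ 2
  | m + 3, γ =>
      (1 - (‖γ 1‖ : ℂ) ^ 2) * schurF (m + 2) (fun i => γ (i + 1)) -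
        conj (γ 1) * ∑ i : Fin (m + 1),
          schurF (m + 1 - i) (fun l => γ (l + 1)) * schurF (i + 2) γ

/-- `G_n(γ₁, …, γ_{n-1}) = F_n(γ₁, …, γ_n) - (1 - |γ₁|²) ⋯ (1 - |γ_{n-1}|²) γ_n`, with `G₁ = 0`.
That the right-hand side does not depend on `γ_n` is `schurG_congr` below. -/
def schurG (n : ℕ) (γ : ℕ → ℂ) : ℂ :=
  schurF n γ - (∏ k ∈ Finset.Icc 1 (n - 1), (1 - (‖γ k‖ : ℂ) ^ 2)) * γ n

/-- The partial Bell polynomial `A_{n,k}(x₁, …, x_{n-k+1})`, for `1 ≤ k ≤ n`: the sum runs over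
all `(j₁, …, j_{n-k+1})` with `∑ j_i = k` and `∑ i j_i = n`. -/
def bellA (n k : ℕ) (x : ℕ → ℂ) : ℂ :=
  ∑ j ∈ (Finset.piAntidiag (Finset.Icc 1 (n - k + 1)) k).filter
      (fun j : ℕ → ℕ => ∑ i ∈ Finset.Icc 1 (n - k + 1), i * j i = n),
    (n.factorial : ℂ) / (∏ i ∈ Finset.Icc 1 (n - k + 1), ((j i).factorial : ℂ)) *
      ∏ i ∈ Finset.Icc 1 (n - k + 1), (x i / (i.factorial : ℂ)) ^ j i

/-- `α_{n,k} = (-1)^(n-k) n! (n-1)! / (k! (k-1)! (n-k)!)` for `1 ≤ k ≤ n`, and `0` otherwise. -/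
def alphaCoeff (n k : ℕ) : ℂ :=
  if 1 ≤ k ∧ k ≤ n then
    (-1) ^ (n - k) * ((n.factorial : ℂ) * ((n - 1).factorial : ℂ)) /
      ((k.factorial : ℂ) * ((k - 1).factorial : ℂ) * ((n - k).factorial : ℂ))
  else 0

/-- The quantity `s_{n-1}(z₀)` as a function of `z₀`, of the value `a = f(z₀)`, of the derivatives
`d k = f^(k)(z₀)` and of Peschl's invariant derivatives `D k = D^k f(z₀)`, `1 ≤ k ≤ n - 1`. -/
def peschlS (n : ℕ) (z₀ a : ℂ) (d D : ℕ → ℂ) : ℂ :=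
  (∑ k ∈ Finset.Icc 1 (n - 1),
      alphaCoeff n k * (conj z₀ ^ (n - k) * (1 - (‖z₀‖ : ℂ) ^ 2) ^ k * d k) /
        (1 - (‖a‖ : ℂ) ^ 2)) -
    ∑ k ∈ Finset.Icc 2 n, (k.factorial : ℂ) * (-conj a) ^ (k - 1) * bellA n k D

/-- `ρ_n = n! ∏_{k=0}^{n-1} (1 - |γ_k|²) / (1 - |z₀|²)^n`. -/
def rho (z₀ : ℂ) (γ : ℕ → ℂ) (n : ℕ) : ℝ :=
  (n.factorial : ℝ) * (∏ k ∈ Finset.range n, (1 - ‖γ k‖ ^ 2)) / (1 - ‖z₀‖ ^ 2) ^ n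

/-- `c₀ = 0` and `c_n = (1 - |γ₀|²) / (1 - |z₀|²)^n * (n! G_n(γ₁, …, γ_{n-1}) - s_{n-1}(z₀))` for
`n ≥ 1`. In `s_{n-1}(z₀)` the value is `γ₀`, the `k`-th derivative, for `1 ≤ k < n`, is
`c_k + ρ_k γ_k`, and the `k`-th invariant derivative is
`k! ((1 - |γ₁|²) ⋯ (1 - |γ_{k-1}|²) γ_k + G_k) = k! F_k(γ₁, …, γ_k)`. -/
def center (z₀ : ℂ) (γ : ℕ → ℂ) : ℕ → ℂ
  | 0 => 0
  | m + 1 =>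
      (1 - (‖γ 0‖ : ℂ) ^ 2) / (1 - (‖z₀‖ : ℂ) ^ 2) ^ (m + 1) *
        (((m + 1).factorial : ℂ) * schurG (m + 1) γ -
          peschlS (m + 1) z₀ (γ 0)
            (fun k => if _h : k < m + 1 then center z₀ γ k + (rho z₀ γ k : ℂ) * γ k else 0)
            (fun k => (k.factorial : ℂ) * schurF k γ))

/-- `c'_n = n c_{n-1} + n ρ_{n-1} γ_{n-1} + z₀ c_n`, for `n ≥ 1` (so `c'₁ = γ₀`). -/
def center' (z₀ : ℂ) (γ : ℕ → ℂ) (n : ℕ) : ℂ :=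
  n * center z₀ γ (n - 1) + n * (rho z₀ γ (n - 1) : ℂ) * γ (n - 1) + z₀ * center z₀ γ n

/-- `ρ'_n = |z₀| ρ_n`. -/
def rho' (z₀ : ℂ) (γ : ℕ → ℂ) (n : ℕ) : ℝ := ‖z₀‖ * rho z₀ γ n

theorem schurF_congr (n : ℕ) : ∀ γ δ : ℕ → ℂ, (∀ k, 1 ≤ k → k ≤ n → γ k = δ k) →
    schurF n γ = schurF n δ := by
  induction n using Nat.strong_induction_on with
  | _ n ih =>
    intro γ δ h
    match n, ih, h with
    | 0, _, _ => simp [schurF]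
    | 1, _, h => simp [schurF, h 1]
    | 2, _, h => simp [schurF, h 1, h 2]
    | m + 3, ih, h =>
      have h1 : γ 1 = δ 1 := h 1 le_rfl (by omega)
      simp only [schurF, h1]
      rw [ih (m + 2) (by omega) (fun i => γ (i + 1)) (fun i => δ (i + 1))
        (fun k _ _ => h (k + 1) (by omega) (by omega))]
      congr 2
      refine Finset.sum_congr rfl fun i _ => ?_
      rw [ih (m + 1 - i) (by omega) (fun i => γ (i + 1)) (fun i => δ (i + 1))
        (fun k _ _ => h (k + 1) (by omega) (by omega)),
        ih (i + 2) (by omega) γ δ (fun k _ _ => h k (by omega) (by omega))]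

theorem schurG_congr (n : ℕ) : ∀ γ δ : ℕ → ℂ, (∀ k, 1 ≤ k → k < n → γ k = δ k) → 1 ≤ n →
    schurG n γ = schurG n δ := by
  induction n using Nat.strong_induction_on with
  | _ n ih =>
    intro γ δ h hn
    match n, ih, h, hn with
    | 1, _, _, _ => simp [schurG, schurF]
    | 2, _, h, _ => simp [schurG, schurF]
    | m + 3, ih, h, _ =>
      have h1 : γ 1 = δ 1 := h 1 le_rfl (by omega)
      have key : ∀ η : ℕ → ℂ, schurG (m + 3) η =
          (1 - (‖η 1‖ : ℂ) ^ 2) * schurG (m + 2) (fun i => η (i + 1)) -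
            conj (η 1) * ∑ i : Fin (m + 1),
              schurF (m + 1 - i) (fun l => η (l + 1)) * schurF (i + 2) η := by
        intro η
        have hp : ∏ k ∈ Finset.Icc 1 (m + 3 - 1), (1 - (‖η k‖ : ℂ) ^ 2) =
            (1 - (‖η 1‖ : ℂ) ^ 2) *
              ∏ k ∈ Finset.Icc 1 (m + 2 - 1), (1 - (‖η (k + 1)‖ : ℂ) ^ 2) := by
          simp only [← Finset.Ico_add_one_right_eq_Icc, Finset.prod_Ico_eq_prod_range]
          simp only [show m + 3 - 1 + 1 - 1 = m + 1 + 1 by omega,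
            show m + 2 - 1 + 1 - 1 = m + 1 by omega]
          rw [Finset.prod_range_succ']
          simp only [add_zero]
          rw [mul_comm]
          congr 1
        simp only [schurG]
        rw [hp, schurF]
        ring
      rw [key γ, key δ, h1, ih (m + 2) (by omega) (fun i => γ (i + 1)) (fun i => δ (i + 1))
        (fun k _ _ => h (k + 1) (by omega) (by omega)) (by omega)]
      congr 2
      refine Finset.sum_congr rfl fun i _ => ?_
      rw [schurF_congr (m + 1 - i) (fun i => γ (i + 1)) (fun i => δ (i + 1))
        (fun k _ _ => h (k + 1) (by omega) (by omega)),
        schurF_congr (i + 2) γ δ (fun k _ _ => h k (by omega) (by omega))]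

end

end Dieudonne

/-! By the Schwarz lemma, h(z) = z f(z) with f in the Schur class. The Schur algorithm at z₀ writes
f(z) = T_{γ₀}(T_{-z₀}(z) f₁(z)) with γ₀ = f(z₀) and f₁ again in the class; iterating it yields
parameters γ₀, γ₁, … for as long as they stay in the open disk. The m-th derivative of h at z₀ is
c'_m + ρ_m z₀ γ_m, where c'_m and ρ_m involve only earlier parameters and ρ_m > 0 if these are in
the open disk. Hence prescribing h(z₀), …, h^(n-1)(z₀) prescribes the parameters
(`exists_eq_mul_nest`). What stays free is the last Schur function g, and h^(n)(z₀) sees only g(z₀),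
through an affine map that carries the closed unit disk onto the claimed disk. A boundary value
means |g(z₀)| = 1, so g is constant by the maximum principle; the same principle ends the algorithm
early when |γ_j| = 1.

The computation lies in the formula for c_m. Moving z₀ to the origin gives f(T_{z₀}(u)) =
T_{γ₀}(ψ(u)), where ψ has the Taylor coefficients F_m (`coeff_taylorPS_mul_nest`). Expanding the
left side produces the α_{m,k}, the right side the Bell polynomials, and solving for the top
derivative gives `iteratedDeriv_eq_peschlS`.

For the Blaschke claim, multiplication by T_{-z₀} raises the degree by one and composition with T_α
preserves it (`IsBlaschkeProduct.diskT_comp`). -/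

/-! ### Formal power series: Bell polynomials and Möbius substitutions -/

open PowerSeries in
-- This is the multinomial expansion of `ψ ^ k`. As `ψ` has no constant term, a product of `k`
-- coefficients with total index `m` uses only indices up to `m - k + 1`, so `ψ` may be replaced by
-- the polynomial `P`.
theorem bellA_eq_coeff_pow (ψ : ℂ⟦X⟧) (hψ : constantCoeff ψ = 0) {m k : ℕ} (hkm : k ≤ m) :
    (k.factorial : ℂ) * Dieudonne.bellA m k (fun i => (i.factorial : ℂ) * coeff i ψ) =
      (m.factorial : ℂ) * coeff m (ψ ^ k) := by
  set s := Finset.Icc 1 (m - k + 1) with hs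
  set P : ℂ⟦X⟧ := ∑ i ∈ s, monomial i (coeff i ψ) with hP
  have hcoeff : ∀ i, i ≤ m - k + 1 → coeff i P = coeff i ψ := by
    intro i hi
    simp only [hP, map_sum, coeff_monomial, Finset.sum_ite_eq]
    split_ifs with h
    · rfl
    · have : i = 0 := by simp only [hs, Finset.mem_Icc] at h; omega
      subst this
      simp [hψ]
  obtain ⟨a, ha⟩ := X_dvd_iff.2 hψ
  obtain ⟨b, hb⟩ := X_dvd_iff.2 (show constantCoeff P = 0 by
    rw [← coeff_zero_eq_constantCoeff_apply, hcoeff 0 (by omega),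
      coeff_zero_eq_constantCoeff_apply, hψ])
  -- After one factor `X` is removed, the series agree to order `m - k + 1`; the factor `X ^ k` of
  -- the powers restores the order `m + 1`.
  have hab : (X : ℂ⟦X⟧) ^ (m - k + 1) ∣ a - b := by
    rw [X_pow_dvd_iff]
    intro i hi
    have := hcoeff (i + 1) (by omega)
    rw [hb, ha, coeff_succ_X_mul, coeff_succ_X_mul] at this
    simp [this]
  have hpow : coeff m (ψ ^ k) = coeff m (P ^ k) := by
    have h1 : (X : ℂ⟦X⟧) ^ (m + 1) ∣ ψ ^ k - P ^ k := by
      rw [ha, hb, mul_pow, mul_pow, ← mul_sub, show m + 1 = k + (m - k + 1) by omega, pow_add]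
      exact mul_dvd_mul_left _ (hab.trans (sub_dvd_pow_sub_pow a b k))
    have := X_pow_dvd_iff.1 h1 m (by omega)
    rwa [map_sub, sub_eq_zero] at this
  rw [hpow, hP, Finset.sum_pow_eq_sum_piAntidiag, map_sum, Dieudonne.bellA, ← hs,
    Finset.sum_filter, Finset.mul_sum, Finset.mul_sum]
  refine Finset.sum_congr rfl fun j hj => ?_
  have hjk : ∑ i ∈ s, j i = k := (Finset.mem_piAntidiag.1 hj).1
  have hprod : ∏ i ∈ s, (monomial i (coeff i ψ)) ^ j i =
      monomial (∑ i ∈ s, i * j i) (∏ i ∈ s, (coeff i ψ) ^ j i) := by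
    clear_value s
    clear hj hjk hP hcoeff hb hpow hs
    induction s using Finset.cons_induction with
    | empty => simp [monomial_zero_eq_C_apply]
    | cons i s hi ih =>
      rw [Finset.prod_cons, Finset.prod_cons, Finset.sum_cons, ih, monomial_pow,
        monomial_mul_monomial, mul_comm (j i)]
  have hmult : ((Nat.multinomial s j : ℕ) : ℂ) * ∏ i ∈ s, ((j i).factorial : ℂ) =
      (k.factorial : ℂ) := by
    have := Nat.multinomial_spec s j
    rw [hjk] at this
    rw [mul_comm, ← this]
    push_cast
    rfl
  have hne : ∏ i ∈ s, ((j i).factorial : ℂ) ≠ 0 :=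
    Finset.prod_ne_zero_iff.2 fun i _ => Nat.cast_ne_zero.2 (Nat.factorial_ne_zero _)
  have hx : ∏ i ∈ s, ((i.factorial : ℂ) * coeff i ψ / (i.factorial : ℂ)) ^ j i =
      ∏ i ∈ s, (coeff i ψ) ^ j i := by
    refine Finset.prod_congr rfl fun i _ => ?_
    rw [mul_div_cancel_left₀ _ (Nat.cast_ne_zero.2 (Nat.factorial_ne_zero _))]
  have hC : ((Nat.multinomial s j : ℕ) : ℂ⟦X⟧) = C ((Nat.multinomial s j : ℕ) : ℂ) := by simp
  rw [hprod, hC, coeff_C_mul, coeff_monomial]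
  by_cases h : ∑ i ∈ s, i * j i = m
  · rw [if_pos h, if_pos h.symm, hx, ← hmult]
    field_simp
  · rw [if_neg h, if_neg (Ne.symm h)]
    simp

open PowerSeries in
-- Here τ = sX / (1 + bX), and the binomial series of (1 + bX)^(-k) gives the coefficients. It
-- serves for τ = T_{z₀} - z₀, with b = conj z₀ and s = 1 - |z₀|².
theorem coeff_pow_of_mul_one_add_eq {τ : ℂ⟦X⟧} {b s : ℂ} (h : τ * (1 + C b * X) = C s * X)
    {m k : ℕ} (hk : 1 ≤ k) :
    (m.factorial : ℂ) / (k.factorial : ℂ) * coeff m (τ ^ k) =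
      Dieudonne.alphaCoeff m k * (b ^ (m - k) * s ^ k) := by
  have hgeo : rescale (-b) (mk 1 : ℂ⟦X⟧) * (1 + C b * X) = 1 := by
    have := congrArg (rescale (-b)) (mk_one_mul_one_sub_eq_one ℂ)
    simpa [rescale_X] using this
  have hτ : τ = C s * X * rescale (-b) (mk 1) := by
    rw [← h, mul_assoc, mul_comm (1 + _), hgeo, mul_one]
  obtain ⟨d, rfl⟩ := Nat.exists_eq_add_of_le' hk
  rw [hτ, mul_pow, mul_pow, ← map_pow, ← map_pow, mul_assoc, coeff_C_mul, coeff_X_pow_mul',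
    mk_one_pow_eq_mk_choose_add, Dieudonne.alphaCoeff]
  by_cases hm : d + 1 ≤ m
  · rw [if_pos hm, if_pos ⟨hk, hm⟩, coeff_rescale, coeff_mk]
    obtain ⟨e, rfl⟩ := Nat.exists_eq_add_of_le hm
    rw [show d + 1 + e - (d + 1) = e by omega, show d + 1 + e - 1 = d + e by omega,
      show d + 1 - 1 = d by omega, Nat.cast_choose ℂ (Nat.le_add_right d e),
      show d + e - d = e by omega, neg_pow]
    field_simp
  · rw [if_neg hm, if_neg (fun h => hm h.2)]
    simp

open PowerSeries in
-- Geometric series for Ψ - a = rψ / (1 + bψ), which is the shape of T_a ∘ ψ. The remainder after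
-- `m` terms has order at least `m + 1`, because Ψ - a contributes one more factor `X`.
theorem coeff_of_mul_one_add_eq {Ψ ψ : ℂ⟦X⟧} (hψ : constantCoeff ψ = 0) {a b r : ℂ}
    (h : (Ψ - C a) * (1 + C b * ψ) = C r * ψ) {m : ℕ} (hm : 1 ≤ m) :
    coeff m Ψ = r * ∑ k ∈ Finset.Icc 1 m, (-b) ^ (k - 1) * coeff m (ψ ^ k) := by
  obtain ⟨q, hq⟩ := X_dvd_iff.2 hψ
  have hdvd : X ∣ Ψ - C a := by
    have : Ψ - C a = X * (C r * q - C b * q * (Ψ - C a)) := by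
      have : Ψ - C a = C r * ψ - C b * ψ * (Ψ - C a) := by rw [← h]; ring
      rw [hq] at this
      linear_combination this
    exact ⟨_, this⟩
  have hgeo := geom_sum_mul (-(C b * ψ)) m
  have h1 : Ψ - C a = C r * ψ * (∑ i ∈ Finset.range m, (-(C b * ψ)) ^ i) +
      (Ψ - C a) * (-(C b * ψ)) ^ m := by
    linear_combination (∑ i ∈ Finset.range m, (-(C b * ψ)) ^ i) * h + (Ψ - C a) * hgeo
  have h2 : coeff m ((Ψ - C a) * (-(C b * ψ)) ^ m) = 0 := by
    suffices h : X ^ (m + 1) ∣ (Ψ - C a) * (-(C b * ψ)) ^ m from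
      X_pow_dvd_iff.1 h m (by omega)
    rw [pow_succ']
    refine mul_dvd_mul hdvd (pow_dvd_pow_of_dvd ?_ m)
    exact ((dvd_mul_right X q).trans hq.symm.dvd |>.mul_left _).neg_right
  have h3 : coeff m (Ψ - C a) = coeff m Ψ := by
    rw [map_sub, coeff_C, if_neg (by omega), sub_zero]
  rw [← h3, h1, map_add, h2, add_zero, Finset.mul_sum, map_sum, Finset.mul_sum,
    ← Finset.Ico_add_one_right_eq_Icc, Finset.sum_Ico_eq_sum_range]
  refine Finset.sum_congr rfl fun i _ => ?_
  have : C r * ψ * (-(C b * ψ)) ^ i = C (r * (-b) ^ i) * ψ ^ (1 + i) := by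
    rw [map_mul, map_pow, map_neg]
    ring
  rw [this, coeff_C_mul, show 1 + i - 1 = i by omega]
  ring

/-! ### Taylor series of analytic functions and composition -/

/-- The Taylor series of `f` at `c` as a formal power series. -/
noncomputable def taylorPS (f : ℂ → ℂ) (c : ℂ) : PowerSeries ℂ :=
  PowerSeries.mk fun k => iteratedDeriv k f c / (k.factorial : ℂ)

theorem coeff_taylorPS (f : ℂ → ℂ) (c : ℂ) (k : ℕ) :
    PowerSeries.coeff k (taylorPS f c) = iteratedDeriv k f c / (k.factorial : ℂ) :=
  PowerSeries.coeff_mk _ _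

theorem iteratedDeriv_eq_factorial_mul_coeff (f : ℂ → ℂ) (c : ℂ) (k : ℕ) :
    iteratedDeriv k f c = (k.factorial : ℂ) * PowerSeries.coeff k (taylorPS f c) := by
  rw [coeff_taylorPS, mul_div_cancel₀ _ (Nat.cast_ne_zero.2 (Nat.factorial_ne_zero _))]

theorem constantCoeff_taylorPS (f : ℂ → ℂ) (c : ℂ) :
    PowerSeries.constantCoeff (taylorPS f c) = f c := by
  rw [← PowerSeries.coeff_zero_eq_constantCoeff_apply, coeff_taylorPS]
  simp

theorem taylorPS_congr {f g : ℂ → ℂ} {c : ℂ} (h : f =ᶠ[nhds c] g) :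
    taylorPS f c = taylorPS g c := by
  ext k
  rw [coeff_taylorPS, coeff_taylorPS, h.iteratedDeriv_eq]

theorem taylorPS_add {f g : ℂ → ℂ} {c : ℂ} (hf : AnalyticAt ℂ f c) (hg : AnalyticAt ℂ g c) :
    taylorPS (fun z => f z + g z) c = taylorPS f c + taylorPS g c := by
  ext k
  rw [map_add, coeff_taylorPS, coeff_taylorPS, coeff_taylorPS,
    iteratedDeriv_fun_add hf.contDiffAt hg.contDiffAt, add_div]

theorem taylorPS_sub {f g : ℂ → ℂ} {c : ℂ} (hf : AnalyticAt ℂ f c) (hg : AnalyticAt ℂ g c) :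
    taylorPS (fun z => f z - g z) c = taylorPS f c - taylorPS g c := by
  ext k
  rw [map_sub, coeff_taylorPS, coeff_taylorPS, coeff_taylorPS,
    iteratedDeriv_fun_sub hf.contDiffAt hg.contDiffAt, sub_div]

theorem taylorPS_mul {f g : ℂ → ℂ} {c : ℂ} (hf : AnalyticAt ℂ f c) (hg : AnalyticAt ℂ g c) :
    taylorPS (fun z => f z * g z) c = taylorPS f c * taylorPS g c := by
  ext k
  rw [coeff_taylorPS, iteratedDeriv_fun_mul hf.contDiffAt hg.contDiffAt, PowerSeries.coeff_mul,
    Finset.Nat.sum_antidiagonal_eq_sum_range_succ_mk, Finset.sum_div]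
  refine Finset.sum_congr rfl fun i hi => ?_
  rw [Nat.cast_choose _ (by grind), coeff_taylorPS, coeff_taylorPS]
  have := Nat.cast_ne_zero (R := ℂ).2 (Nat.factorial_ne_zero k)
  field_simp

theorem taylorPS_const (a c : ℂ) : taylorPS (fun _ => a) c = PowerSeries.C a := by
  ext k
  rw [coeff_taylorPS, iteratedDeriv_const, PowerSeries.coeff_C]
  split_ifs with h <;> simp [h]

theorem taylorPS_sub_const (c : ℂ) : taylorPS (fun z => z - c) c = PowerSeries.X := by
  ext k
  rw [coeff_taylorPS, PowerSeries.coeff_X]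
  match k with
  | 0 => simp
  | 1 => simp [iteratedDeriv_one]
  | k + 2 =>
    have : iteratedDeriv (k + 2) (fun z : ℂ => z - c) c = 0 := by
      have h1 : deriv (fun z : ℂ => z - c) = fun _ => 1 := by ext z; simp
      rw [iteratedDeriv_succ', h1, iteratedDeriv_const, if_neg (by omega)]
    simp [this]

theorem taylorPS_id : taylorPS (fun z => z) 0 = PowerSeries.X := by
  simpa using taylorPS_sub_const 0

theorem analyticAt_dslope {f : ℂ → ℂ} {c : ℂ} (hf : AnalyticAt ℂ f c) :
    AnalyticAt ℂ (dslope f c) c :=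
  let ⟨_, hp⟩ := hf
  ⟨_, hp.has_fpower_series_dslope_fslope⟩

theorem eq_add_mul_dslope (f : ℂ → ℂ) (c z : ℂ) : f z = f c + (z - c) * dslope f c z := by
  have := sub_smul_dslope f c z
  rw [smul_eq_mul] at this
  rw [this]
  ring

theorem coeff_taylorPS_dslope {f : ℂ → ℂ} {c : ℂ} (hf : AnalyticAt ℂ f c) (k : ℕ) :
    PowerSeries.coeff k (taylorPS (dslope f c) c) = PowerSeries.coeff (k + 1) (taylorPS f c) := by
  have h : taylorPS f c = PowerSeries.C (f c) + PowerSeries.X * taylorPS (dslope f c) c := by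
    rw [← taylorPS_const (f c) c, ← taylorPS_sub_const c,
      ← taylorPS_mul (by fun_prop) (analyticAt_dslope hf),
      ← taylorPS_add analyticAt_const ((by fun_prop : AnalyticAt ℂ (fun z => z - c) c).fun_mul
        (analyticAt_dslope hf))]
    exact congrArg (taylorPS · c) (funext (eq_add_mul_dslope f c))
  rw [h, map_add, PowerSeries.coeff_C, if_neg (by omega), zero_add, PowerSeries.coeff_succ_X_mul]

/-- Iterating f = f(c) + (z - c) · `dslope` replaces Faà di Bruno's formula. Each division by z - c
shifts the coefficients of `f` and leaves a factor `T u - T c`, which vanishes at `c`. -/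
theorem X_pow_dvd_taylorPS_comp_sub {T : ℂ → ℂ} {c : ℂ} (hT : AnalyticAt ℂ T c) (m : ℕ) :
    ∀ f : ℂ → ℂ, AnalyticAt ℂ f (T c) →
      (PowerSeries.X : PowerSeries ℂ) ^ m ∣ taylorPS (fun u => f (T u)) c -
        ∑ k ∈ Finset.range m, PowerSeries.C (PowerSeries.coeff k (taylorPS f (T c))) *
          taylorPS (fun u => T u - T c) c ^ k := by
  induction m with
  | zero => simp
  | succ m ih =>
    intro f hf
    have hd := analyticAt_dslope hf
    have hTc : AnalyticAt ℂ (fun u => T u - T c) c := hT.sub analyticAt_const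
    have hdT : AnalyticAt ℂ (fun u => dslope f (T c) (T u)) c := hd.comp hT
    have h : taylorPS (fun u => f (T u)) c = PowerSeries.C (f (T c)) +
        taylorPS (fun u => T u - T c) c * taylorPS (fun u => dslope f (T c) (T u)) c := by
      rw [← taylorPS_const (f (T c)) c, ← taylorPS_mul hTc hdT,
        ← taylorPS_add analyticAt_const (hTc.fun_mul hdT)]
      exact congrArg (taylorPS · c) (funext fun u => eq_add_mul_dslope f (T c) (T u))
    have h2 : (PowerSeries.X : PowerSeries ℂ) ∣ taylorPS (fun u => T u - T c) c := by
      rw [PowerSeries.X_dvd_iff, constantCoeff_taylorPS, sub_self]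
    have h3 := mul_dvd_mul h2 (ih _ hd)
    rw [← pow_succ'] at h3
    convert h3 using 1
    rw [Finset.sum_range_succ', h, mul_sub, Finset.mul_sum]
    simp only [coeff_taylorPS_dslope hf, pow_zero, mul_one,
      PowerSeries.coeff_zero_eq_constantCoeff_apply, constantCoeff_taylorPS]
    rw [add_comm (PowerSeries.C _), add_sub_add_right_eq_sub]
    congr 1
    refine Finset.sum_congr rfl fun i _ => ?_
    ring

theorem coeff_taylorPS_comp {f T : ℂ → ℂ} {c : ℂ} (hT : AnalyticAt ℂ T c)
    (hf : AnalyticAt ℂ f (T c)) (m : ℕ) :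
    PowerSeries.coeff m (taylorPS (fun u => f (T u)) c) =
      ∑ k ∈ Finset.range (m + 1), PowerSeries.coeff k (taylorPS f (T c)) *
        PowerSeries.coeff m (taylorPS (fun u => T u - T c) c ^ k) := by
  have := PowerSeries.X_pow_dvd_iff.1 (X_pow_dvd_taylorPS_comp_sub hT (m + 1) f hf) m (by omega)
  rw [map_sub, sub_eq_zero, map_sum] at this
  simpa only [PowerSeries.coeff_C_mul] using this

/-! ### Disk automorphisms and nested functions -/

namespace Dieudonne

theorem diskT_zero (a : ℂ) : diskT a 0 = a := by simp [diskT]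

theorem diskT_zero_left (z : ℂ) : diskT 0 z = z := by simp [diskT]

theorem diskT_neg_self (a : ℂ) : diskT (-a) a = 0 := by simp [diskT]

theorem conj_mul_self_eq (a : ℂ) : conj a * a = (‖a‖ : ℂ) ^ 2 := by
  rw [mul_comm, Complex.mul_conj']

theorem one_sub_norm_sq_ne_zero {a : ℂ} (ha : ‖a‖ < 1) : (1 - (‖a‖ : ℂ) ^ 2) ≠ 0 := by
  have : (1 - ‖a‖ ^ 2 : ℝ) ≠ 0 := by nlinarith [norm_nonneg a]
  exact_mod_cast this

theorem one_add_conj_mul_ne_zero {a z : ℂ} (ha : ‖a‖ < 1) (hz : ‖z‖ ≤ 1) :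
    1 + conj a * z ≠ 0 := by
  intro h
  have h1 : ‖conj a * z‖ = 1 := by
    rw [← neg_eq_of_add_eq_zero_right h, norm_neg, norm_one]
  rw [norm_mul, RCLike.norm_conj] at h1
  nlinarith [norm_nonneg a, norm_nonneg z]

theorem diskT_neg_diskT {a u : ℂ} (ha : ‖a‖ < 1) (hu : ‖u‖ ≤ 1) :
    diskT (-a) (diskT a u) = u := by
  have h1 := one_add_conj_mul_ne_zero ha hu
  have h2 := one_sub_norm_sq_ne_zero ha
  rw [← conj_mul_self_eq] at h2
  simp only [diskT, map_neg]
  have h3 : 1 + -conj a * ((u + a) / (1 + conj a * u)) =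
      (1 - conj a * a) / (1 + conj a * u) := by
    field_simp
    ring
  rw [h3, div_add' _ _ _ h1, div_div_div_cancel_right₀ h1, div_eq_iff h2]
  ring

theorem analyticAt_diskT {a z : ℂ} (h : 1 + conj a * z ≠ 0) : AnalyticAt ℂ (diskT a) z := by
  unfold diskT
  fun_prop (disch := exact h)

theorem analyticAt_nest {z₀ : ℂ} (hz₀ : ‖z₀‖ < 1) {g : ℂ → ℂ} (hg : AnalyticAt ℂ g z₀) (m : ℕ) :
    ∀ γ : ℕ → ℂ, AnalyticAt ℂ (nest z₀ m γ g) z₀ := by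
  induction m with
  | zero => exact fun _ => hg
  | succ m ih =>
    intro γ
    have h1 : AnalyticAt ℂ (diskT (-z₀)) z₀ :=
      analyticAt_diskT (one_add_conj_mul_ne_zero (by rwa [norm_neg]) hz₀.le)
    have h2 := h1.fun_mul (ih fun i => γ (i + 1))
    refine AnalyticAt.fun_comp (g := diskT (γ 0)) (analyticAt_diskT ?_) h2
    simp [diskT_neg_self]

theorem nest_congr {z₀ : ℂ} {g g' : ℂ → ℂ} {z : ℂ} (hg : g z = g' z) (m : ℕ) :
    ∀ γ δ : ℕ → ℂ, (∀ k < m, γ k = δ k) → nest z₀ m γ g z = nest z₀ m δ g' z := by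
  induction m with
  | zero => exact fun _ _ _ => hg
  | succ m ih =>
    intro γ δ h
    simp only [nest]
    rw [h 0 (by omega), ih _ (fun i => δ (i + 1)) fun k hk => h (k + 1) (by omega)]

/-- The substitution z = T_{z₀}(u) turns every T_{-z₀}(z) into u, so the expansion at z₀ reduces to
the classical one at the origin. -/
theorem nest_diskT {z₀ u : ℂ} (hz₀ : ‖z₀‖ < 1) (hu : ‖u‖ ≤ 1) (g : ℂ → ℂ) (m : ℕ) :
    ∀ γ : ℕ → ℂ, nest z₀ m γ g (diskT z₀ u) = nest 0 m γ (fun v => g (diskT z₀ v)) u := by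
  induction m with
  | zero => exact fun _ => rfl
  | succ m ih =>
    intro γ
    simp only [nest]
    rw [ih, diskT_neg_diskT hz₀ hu, neg_zero, diskT_zero_left]

theorem nest_self (z₀ : ℂ) (m : ℕ) (γ : ℕ → ℂ) (g : ℂ → ℂ) : nest z₀ (m + 1) γ g z₀ = γ 0 := by
  simp [nest, diskT_neg_self, diskT_zero]

/-! ### The polynomials F_m as Taylor coefficients -/

/-- The full convolution is what comparing coefficients yields. Its term with first index 1 accounts
for -|γ₁|² in the factor 1 - |γ₁|², and the end terms vanish since F₀ = 0. -/
theorem schurF_succ (m : ℕ) (γ : ℕ → ℂ) :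
    schurF (m + 1) γ = schurF m (fun i => γ (i + 1)) + (if m = 0 then γ 1 else 0) -
      conj (γ 1) * ∑ p ∈ Finset.HasAntidiagonal.antidiagonal (m + 1),
        schurF p.1 γ * schurF p.2 (fun i => γ (i + 1)) := by
  match m with
  | 0 => simp [schurF, Finset.Nat.antidiagonal_succ]
  | 1 =>
    simp [schurF, Finset.Nat.antidiagonal_succ, ← conj_mul_self_eq]
    ring
  | m + 2 =>
    rw [Finset.Nat.sum_antidiagonal_eq_sum_range_succ
      (fun i j => schurF i γ * schurF j (fun i => γ (i + 1))), Finset.sum_range_succ',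
      Finset.sum_range_succ', Finset.sum_range_succ]
    rw [schurF.eq_4, Finset.sum_range, ← conj_mul_self_eq]
    have h0 : ∀ δ, schurF 0 δ = 0 := fun δ => by simp [schurF]
    have h1 : ∀ δ, schurF 1 δ = δ 1 := fun δ => by simp [schurF]
    simp only [if_neg (show m + 2 ≠ 0 by omega), zero_add, h0, h1,
      show m + 2 + 1 - (m + 1 + 1 + 1) = 0 by omega, show m + 2 + 1 - 1 = m + 2 by omega]
    have : ∀ i : Fin (m + 1), m + 2 + 1 - ((i : ℕ) + 1 + 1) = m + 1 - i := fun i => by omega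
    simp only [this]
    simp only [add_assoc, one_add_one_eq_two, mul_comm (schurF (m + 1 - _) _)]
    ring

/-- With φ the function built on γ₁, γ₂, … and ψ the one built on γ₂, …, clearing the denominator of
T_{γ₁} gives φ(1 + conj γ₁ ψ) = u(ψ + γ₁), whose coefficients obey `schurF_succ`. The value of `g`
at 0 is the last parameter. -/
theorem coeff_taylorPS_mul_nest (m : ℕ) : ∀ (γ : ℕ → ℂ) (g : ℂ → ℂ), AnalyticAt ℂ g 0 →
    g 0 = γ (m + 1) → ∀ k ≤ m + 1,
      PowerSeries.coeff k (taylorPS (fun u => u * nest 0 m (fun i => γ (i + 1)) g u) 0) =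
        schurF k γ := by
  induction m with
  | zero =>
    intro γ g hg hg0 k hk
    have hmul : taylorPS (fun u => u * g u) 0 = PowerSeries.X * taylorPS g 0 := by
      rw [taylorPS_mul (by fun_prop) hg, taylorPS_id]
    simp only [nest]
    rw [hmul]
    match k, hk with
    | 0, _ => simp [schurF]
    | 1, _ =>
      rw [← zero_add 1, PowerSeries.coeff_succ_X_mul,
        PowerSeries.coeff_zero_eq_constantCoeff_apply, constantCoeff_taylorPS, hg0]
      simp [schurF]
  | succ m ih =>
    intro γ g hg hg0
    set ψ : ℂ → ℂ := fun u => u * nest 0 m (fun i => γ (i + 2)) g u with hψ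
    set φ : ℂ → ℂ := fun u => u * nest 0 (m + 1) (fun i => γ (i + 1)) g u with hφ
    have hn : ∀ j δ, AnalyticAt ℂ (fun u => nest 0 j δ g u) 0 := fun j δ =>
      analyticAt_nest (by simp) hg j δ
    have hψa : AnalyticAt ℂ ψ 0 := analyticAt_id.fun_mul (hn _ _)
    have hφa : AnalyticAt ℂ φ 0 := analyticAt_id.fun_mul (hn _ _)
    have hψ0 : ψ 0 = 0 := by simp [hψ]
    have hφ0 : φ 0 = 0 := by simp [hφ]
    have hψk : ∀ k ≤ m + 1, PowerSeries.coeff k (taylorPS ψ 0) = schurF k (fun i => γ (i + 1)) :=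
      ih (fun i => γ (i + 1)) g hg hg0
    have hev : (fun u => φ u * (1 + conj (γ 1) * ψ u)) =ᶠ[nhds 0]
        fun u => u * (ψ u + γ 1) := by
      have hc : ContinuousAt (fun u => 1 + conj (γ 1) * ψ u) 0 :=
        continuousAt_const.add (continuousAt_const.mul hψa.continuousAt)
      filter_upwards [hc.eventually_ne (y := 0) (by simp [hψ0])] with u hu
      simp only [hφ, nest, neg_zero, diskT_zero_left]
      rw [diskT]
      change u * ((ψ u + γ 1) / (1 + conj (γ 1) * ψ u)) * _ = _
      rw [mul_assoc, div_mul_cancel₀ _ hu]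
    have hps : taylorPS φ 0 * (1 + PowerSeries.C (conj (γ 1)) * taylorPS ψ 0) =
        PowerSeries.X * (taylorPS ψ 0 + PowerSeries.C (γ 1)) := by
      have := taylorPS_congr hev
      have e1 : AnalyticAt ℂ (fun u => conj (γ 1) * ψ u) 0 := analyticAt_const.fun_mul hψa
      rwa [taylorPS_mul hφa (analyticAt_const.fun_add e1), taylorPS_add analyticAt_const e1,
        taylorPS_mul analyticAt_const hψa, taylorPS_const, taylorPS_const, map_one,
        taylorPS_mul (by fun_prop) (hψa.fun_add analyticAt_const),
        taylorPS_add hψa analyticAt_const, taylorPS_const, taylorPS_id] at this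
    have hφc0 : PowerSeries.coeff 0 (taylorPS φ 0) = 0 := by
      rw [PowerSeries.coeff_zero_eq_constantCoeff_apply, constantCoeff_taylorPS, hφ0]
    have h0 : ∀ δ, schurF 0 δ = 0 := fun δ => by simp [schurF]
    intro k
    induction k using Nat.strong_induction_on with
    | _ k ihk =>
      intro hk
      match k, ihk, hk with
      | 0, _, _ => rw [h0, hφc0]
      | k + 1, ihk, hk =>
        have h1 := congrArg (PowerSeries.coeff (k + 1)) hps
        rw [PowerSeries.coeff_succ_X_mul, mul_add, mul_one, mul_left_comm, map_add, map_add,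
          PowerSeries.coeff_C_mul, PowerSeries.coeff_mul, PowerSeries.coeff_C,
          hψk k (by omega)] at h1
        rw [schurF_succ, ← h1, add_sub_assoc, left_eq_add, sub_eq_zero]
        congr 1
        refine Finset.sum_congr rfl fun p hp => ?_
        have hp' := Finset.HasAntidiagonal.mem_antidiagonal.1 hp
        -- Since F₀ = 0, the end terms need neither the coefficient of φ being computed nor a
        -- coefficient of ψ beyond the known range.
        obtain h2 | h2 : p.2 = 0 ∨ p.1 < k + 1 := by omega
        · rw [h2, hψk 0 (by omega), h0, mul_zero, mul_zero]
        · rw [ihk p.1 h2 (by omega)]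
          obtain h3 | h3 : p.1 = 0 ∨ p.2 ≤ m + 1 := by omega
          · rw [h3, h0, zero_mul, zero_mul]
          · rw [hψk p.2 h3]

/-! ### Peschl's formula and the derivatives of nested functions -/

theorem bellA_congr {m k : ℕ} {x y : ℕ → ℂ} (h : ∀ i, 1 ≤ i → i ≤ m - k + 1 → x i = y i) :
    bellA m k x = bellA m k y := by
  unfold bellA
  refine Finset.sum_congr rfl fun j _ => ?_
  congr 1
  refine Finset.prod_congr rfl fun i hi => ?_
  rw [Finset.mem_Icc] at hi
  rw [h i hi.1 hi.2]

theorem peschlS_congr {m : ℕ} {z₀ a : ℂ} {d d' D D' : ℕ → ℂ}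
    (hd : ∀ k, 1 ≤ k → k < m → d k = d' k) (hD : ∀ k, 1 ≤ k → k < m → D k = D' k) :
    peschlS m z₀ a d D = peschlS m z₀ a d' D' := by
  unfold peschlS
  congr 1
  · refine Finset.sum_congr rfl fun k hk => ?_
    rw [Finset.mem_Icc] at hk
    rw [hd k hk.1 (by omega)]
  · refine Finset.sum_congr rfl fun k hk => ?_
    rw [Finset.mem_Icc] at hk
    rw [bellA_congr fun i hi hi' => hD i hi (by omega)]

theorem rho_congr {z₀ : ℂ} {γ δ : ℕ → ℂ} {m : ℕ} (h : ∀ k < m, γ k = δ k) :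
    rho z₀ γ m = rho z₀ δ m := by
  unfold rho
  rw [Finset.prod_congr rfl fun k hk => by rw [h k (Finset.mem_range.1 hk)]]

theorem center_congr {z₀ : ℂ} {γ δ : ℕ → ℂ} (m : ℕ) (h : ∀ k < m, γ k = δ k) :
    center z₀ γ m = center z₀ δ m := by
  induction m using Nat.strong_induction_on with
  | _ m ih =>
    match m, ih, h with
    | 0, _, _ => simp [center]
    | m + 1, ih, h =>
      rw [center, center, h 0 (by omega),
        schurG_congr (m + 1) γ δ (fun k _ hk => h k hk) (by omega)]
      congr 2
      refine peschlS_congr (fun k _ hk => ?_) fun k _ hk => ?_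
      · rw [dif_pos hk, dif_pos hk, ih k hk fun i hi => h i (by omega), h k hk,
          rho_congr fun i hi => h i (by omega)]
      · rw [schurF_congr k γ δ fun i _ hi => h i (by omega)]

theorem center'_congr {z₀ : ℂ} {γ δ : ℕ → ℂ} {m : ℕ} (hm : 1 ≤ m) (h : ∀ k < m, γ k = δ k) :
    center' z₀ γ m = center' z₀ δ m := by
  unfold center'
  rw [center_congr m h, center_congr (m - 1) fun k hk => h k (by omega), h (m - 1) (by omega),
    rho_congr fun k hk => h k (by omega)]

theorem bellA_one (ψ : PowerSeries ℂ) (hψ : PowerSeries.constantCoeff ψ = 0) {m : ℕ}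
    (hm : 1 ≤ m) :
    bellA m 1 (fun i => (i.factorial : ℂ) * PowerSeries.coeff i ψ) =
      (m.factorial : ℂ) * PowerSeries.coeff m ψ := by
  simpa using bellA_eq_coeff_pow ψ hψ hm

theorem alphaCoeff_self {m : ℕ} (hm : 1 ≤ m) : alphaCoeff m m = 1 := by
  have h1 := Nat.cast_ne_zero (R := ℂ).2 (Nat.factorial_ne_zero m)
  have h2 := Nat.cast_ne_zero (R := ℂ).2 (Nat.factorial_ne_zero (m - 1))
  simp [alphaCoeff, hm, h1, h2]

/-- Peschl's formula for `f⁽ᵐ⁾(z₀)` in terms of the lower derivatives and of the Taylor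
coefficients of `T_{-f(z₀)} ∘ f ∘ T_{z₀}` at the origin. -/
theorem iteratedDeriv_eq_peschlS {z₀ a : ℂ} (hz₀ : ‖z₀‖ < 1) (ha : ‖a‖ < 1) {f ψ : ℂ → ℂ}
    (hf : AnalyticAt ℂ f z₀) (hψ : AnalyticAt ℂ ψ 0) (hψ0 : ψ 0 = 0)
    (h : (fun u => f (diskT z₀ u)) =ᶠ[nhds 0] fun u => diskT a (ψ u)) {m : ℕ} (hm : 1 ≤ m) :
    iteratedDeriv m f z₀ = (1 - (‖a‖ : ℂ) ^ 2) / (1 - (‖z₀‖ : ℂ) ^ 2) ^ m *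
      (iteratedDeriv m ψ 0 - peschlS m z₀ a (fun k => iteratedDeriv k f z₀)
        (fun k => iteratedDeriv k ψ 0)) := by
  have hra := one_sub_norm_sq_ne_zero ha
  have hrz := one_sub_norm_sq_ne_zero hz₀
  have hTa : AnalyticAt ℂ (diskT z₀) 0 := analyticAt_diskT (by simp)
  have hfT : AnalyticAt ℂ (fun u => f (diskT z₀ u)) 0 :=
    AnalyticAt.fun_comp (g := f) (by rwa [diskT_zero]) hTa
  have hψc : PowerSeries.constantCoeff (taylorPS ψ 0) = 0 := by
    rw [constantCoeff_taylorPS, hψ0]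
  have hτ : taylorPS (fun u => diskT z₀ u - z₀) 0 * (1 + PowerSeries.C (conj z₀) * PowerSeries.X) =
      PowerSeries.C (1 - (‖z₀‖ : ℂ) ^ 2) * PowerSeries.X := by
    have hev : (fun u => (diskT z₀ u - z₀) * (1 + conj z₀ * u)) =ᶠ[nhds 0]
        fun u => (1 - (‖z₀‖ : ℂ) ^ 2) * u := by
      have hc : ContinuousAt (fun u => 1 + conj z₀ * u) 0 := by fun_prop
      filter_upwards [hc.eventually_ne (y := 0) (by simp)] with u hu
      rw [sub_mul, diskT, div_mul_cancel₀ _ hu, ← conj_mul_self_eq]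
      ring
    have := taylorPS_congr hev
    rwa [taylorPS_mul (hTa.fun_sub analyticAt_const) (by fun_prop),
      taylorPS_add analyticAt_const (by fun_prop), taylorPS_mul analyticAt_const (by fun_prop),
      taylorPS_const, taylorPS_const, map_one, taylorPS_id,
      taylorPS_mul analyticAt_const (by fun_prop), taylorPS_const, taylorPS_id] at this
  have hΨ : (taylorPS (fun u => f (diskT z₀ u)) 0 - PowerSeries.C a) *
      (1 + PowerSeries.C (conj a) * taylorPS ψ 0) =
        PowerSeries.C (1 - (‖a‖ : ℂ) ^ 2) * taylorPS ψ 0 := by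
    have hev : (fun u => (f (diskT z₀ u) - a) * (1 + conj a * ψ u)) =ᶠ[nhds 0]
        fun u => (1 - (‖a‖ : ℂ) ^ 2) * ψ u := by
      have hc : ContinuousAt (fun u => 1 + conj a * ψ u) 0 :=
        continuousAt_const.add (continuousAt_const.mul hψ.continuousAt)
      filter_upwards [hc.eventually_ne (y := 0) (by simp [hψ0]), h] with u hu hu'
      rw [hu', sub_mul, diskT, div_mul_cancel₀ _ hu, ← conj_mul_self_eq]
      ring
    have := taylorPS_congr hev
    have e1 : AnalyticAt ℂ (fun u => conj a * ψ u) 0 := analyticAt_const.fun_mul hψ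
    rwa [taylorPS_mul (hfT.fun_sub analyticAt_const) (analyticAt_const.fun_add e1),
      taylorPS_add analyticAt_const e1, taylorPS_mul analyticAt_const hψ,
      taylorPS_const, taylorPS_const, map_one, taylorPS_sub hfT analyticAt_const, taylorPS_const,
      taylorPS_mul analyticAt_const hψ, taylorPS_const] at this
  have h1 := coeff_of_mul_one_add_eq hψc hΨ hm
  have h2 := coeff_taylorPS_comp (f := f) hTa (by rwa [diskT_zero]) m
  simp only [diskT_zero] at h2
  -- The m-th coefficient of f ∘ T_{z₀} is computed twice: through the inner map here, through the
  -- outer map T_a in `h4`.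
  have h3 : (m.factorial : ℂ) * PowerSeries.coeff m (taylorPS (fun u => f (diskT z₀ u)) 0) =
      ∑ k ∈ Finset.Icc 1 m, alphaCoeff m k *
        (conj z₀ ^ (m - k) * (1 - (‖z₀‖ : ℂ) ^ 2) ^ k * iteratedDeriv k f z₀) := by
    rw [h2, Finset.sum_range_succ', pow_zero, PowerSeries.coeff_one, if_neg (by omega), mul_zero,
      add_zero, ← Finset.Ico_add_one_right_eq_Icc, Finset.sum_Ico_eq_sum_range, Finset.mul_sum]
    refine Finset.sum_congr rfl fun k _ => ?_
    rw [add_comm 1 k, ← mul_assoc (alphaCoeff _ _),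
      ← coeff_pow_of_mul_one_add_eq hτ (by omega), coeff_taylorPS]
    ring
  have h4 : (m.factorial : ℂ) * PowerSeries.coeff m (taylorPS (fun u => f (diskT z₀ u)) 0) =
      (1 - (‖a‖ : ℂ) ^ 2) * ∑ k ∈ Finset.Icc 1 m, (k.factorial : ℂ) * (-conj a) ^ (k - 1) *
        bellA m k (fun k => iteratedDeriv k ψ 0) := by
    rw [h1, mul_left_comm, Finset.mul_sum]
    congr 1
    refine Finset.sum_congr rfl fun k hk => ?_
    rw [Finset.mem_Icc] at hk
    simp only [iteratedDeriv_eq_factorial_mul_coeff ψ]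
    rw [mul_right_comm, bellA_eq_coeff_pow _ hψc hk.2]
    ring
  obtain ⟨m, rfl⟩ := Nat.exists_eq_add_of_le' hm
  -- The term k = m on the left carries the m-th derivative of `f`, the term k = 1 on the right that
  -- of ψ; the other terms form `peschlS`.
  rw [h3, Finset.sum_Icc_succ_top (by omega), alphaCoeff_self (by omega),
    ← Finset.add_sum_Ioc_eq_sum_Icc (a := 1) (b := m + 1) (by omega)] at h4
  have h5 : bellA (m + 1) 1 (fun k => iteratedDeriv k ψ 0) = iteratedDeriv (m + 1) ψ 0 := by
    simp only [iteratedDeriv_eq_factorial_mul_coeff ψ]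
    exact bellA_one _ hψc (by omega)
  have h6 : Finset.Ioc 1 (m + 1) = Finset.Icc 2 (m + 1) := rfl
  rw [h5, h6] at h4
  rw [peschlS, ← Finset.sum_div, div_mul_eq_mul_div, eq_div_iff (pow_ne_zero _ hrz)]
  simp only [tsub_self, pow_zero, one_mul, Nat.factorial_one, Nat.cast_one] at h4
  rw [Nat.add_sub_cancel]
  field_simp
  simp only [mul_assoc] at h4 ⊢
  linear_combination h4

/-- The recursion for `center` is Peschl's formula with the lower derivatives already known.
Splitting F_m into G_m and its term in γ_m separates `center` from `rho`. -/
theorem iteratedDeriv_nest_eq_center_add {z₀ : ℂ} {γ : ℕ → ℂ} (hz₀ : ‖z₀‖ < 1) (hγ₀ : ‖γ 0‖ < 1)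
    {g : ℂ → ℂ} (hg : AnalyticAt ℂ g z₀) {n : ℕ} (hn : 1 ≤ n) (hgn : g z₀ = γ n) (m : ℕ)
    (hm : m ≤ n) :
    iteratedDeriv m (nest z₀ n γ g) z₀ = center z₀ γ m + (rho z₀ γ m : ℂ) * γ m := by
  obtain ⟨N, rfl⟩ := Nat.exists_eq_add_of_le' hn
  induction m using Nat.strong_induction_on with
  | _ m ih =>
    match m, ih, hm with
    | 0, _, _ => simp [nest_self, center, rho]
    | m + 1, ih, hm =>
      set ψ : ℂ → ℂ :=
        fun u => u * nest 0 N (fun i => γ (i + 1)) (fun v => g (diskT z₀ v)) u with hψ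
      have hgT : AnalyticAt ℂ (fun v => g (diskT z₀ v)) 0 :=
        AnalyticAt.fun_comp (g := g) (by rwa [diskT_zero]) (analyticAt_diskT (by simp))
      have hψa : AnalyticAt ℂ ψ 0 := analyticAt_id.fun_mul (analyticAt_nest (by simp) hgT _ _)
      have hψk : ∀ k ≤ N + 1, iteratedDeriv k ψ 0 = (k.factorial : ℂ) * schurF k γ := by
        intro k hk
        rw [iteratedDeriv_eq_factorial_mul_coeff,
          coeff_taylorPS_mul_nest N γ _ hgT (by rw [diskT_zero, hgn]) k hk]
      have hev : (fun u => nest z₀ (N + 1) γ g (diskT z₀ u)) =ᶠ[nhds 0]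
          fun u => diskT (γ 0) (ψ u) := by
        filter_upwards [Metric.ball_mem_nhds (0 : ℂ) one_pos] with u hu
        rw [nest_diskT hz₀ (by simpa using (mem_ball_zero_iff.1 hu).le)]
        simp only [nest, neg_zero, diskT_zero_left, hψ]
      rw [iteratedDeriv_eq_peschlS hz₀ hγ₀ (analyticAt_nest hz₀ hg _ _) hψa (by simp [hψ]) hev
        (by omega), hψk _ hm, center, peschlS_congr
        (d' := fun k => if _h : k < m + 1 then center z₀ γ k + (rho z₀ γ k : ℂ) * γ k else 0)
        (D' := fun k => (k.factorial : ℂ) * schurF k γ)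
        (fun k _ hk => by rw [dif_pos hk, ih k hk (by omega)])
        (fun k _ hk => hψk k (by omega))]
      have hρ : (rho z₀ γ (m + 1) : ℂ) = (1 - (‖γ 0‖ : ℂ) ^ 2) / (1 - (‖z₀‖ : ℂ) ^ 2) ^ (m + 1) *
          (((m + 1).factorial : ℂ) * ∏ k ∈ Finset.Icc 1 m, (1 - (‖γ k‖ : ℂ) ^ 2)) := by
        rw [rho, Finset.prod_range_succ', ← Finset.Ico_add_one_right_eq_Icc,
          Finset.prod_Ico_eq_prod_range]
        push_cast
        simp only [add_comm 1]
        ring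
      rw [hρ, schurG, Nat.add_sub_cancel]
      ring

/-- The value of the `m`-th derivative of `z ↦ z * nest z₀ n γ g z` at `z₀`. -/
theorem iteratedDeriv_mul_nest_of_apply_eq {z₀ : ℂ} {γ : ℕ → ℂ} (hz₀ : ‖z₀‖ < 1) (hγ₀ : ‖γ 0‖ < 1)
    {g : ℂ → ℂ} (hg : AnalyticAt ℂ g z₀) {n : ℕ} (hn : 1 ≤ n) (hgn : g z₀ = γ n) {m : ℕ}
    (hm : 1 ≤ m) (hmn : m ≤ n) {h : ℂ → ℂ} (hh : h =ᶠ[nhds z₀] fun z => z * nest z₀ n γ g z) :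
    iteratedDeriv m h z₀ = center' z₀ γ m + (rho z₀ γ m : ℂ) * z₀ * γ m := by
  obtain ⟨m, rfl⟩ := Nat.exists_eq_add_of_le' hm
  have hF : AnalyticAt ℂ (fun z => nest z₀ n γ g z) z₀ := analyticAt_nest hz₀ hg _ _
  have h1 : taylorPS (fun z => z) z₀ = PowerSeries.X + PowerSeries.C z₀ := by
    rw [← taylorPS_sub_const z₀, ← taylorPS_const z₀ z₀,
      ← taylorPS_add (by fun_prop) analyticAt_const]
    simp
  have h2 : taylorPS h z₀ = (PowerSeries.X + PowerSeries.C z₀) * taylorPS (nest z₀ n γ g) z₀ := by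
    rw [taylorPS_congr hh, taylorPS_mul (by fun_prop) hF, h1]
  rw [iteratedDeriv_eq_factorial_mul_coeff, h2, add_mul, map_add, PowerSeries.coeff_succ_X_mul,
    PowerSeries.coeff_C_mul, coeff_taylorPS, coeff_taylorPS,
    iteratedDeriv_nest_eq_center_add hz₀ hγ₀ hg hn hgn _ (by omega),
    iteratedDeriv_nest_eq_center_add hz₀ hγ₀ hg hn hgn _ hmn, center', Nat.add_sub_cancel,
    Nat.factorial_succ]
  have := Nat.cast_ne_zero (R := ℂ).2 (Nat.factorial_ne_zero m)
  have := Nat.cast_add_one_ne_zero (R := ℂ) m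
  push_cast
  field_simp
  ring

theorem iteratedDeriv_mul_nest {z₀ : ℂ} {γ : ℕ → ℂ} (hz₀ : ‖z₀‖ < 1) (hγ₀ : ‖γ 0‖ < 1)
    {g : ℂ → ℂ} (hg : AnalyticAt ℂ g z₀) {n : ℕ} (hn : 1 ≤ n)
    {h : ℂ → ℂ} (hh : h =ᶠ[nhds z₀] fun z => z * nest z₀ n γ g z) :
    iteratedDeriv n h z₀ = center' z₀ γ n + (rho z₀ γ n : ℂ) * z₀ * g z₀ ∧
    ∀ m, 1 ≤ m → m < n →
      iteratedDeriv m h z₀ = center' z₀ γ m + (rho z₀ γ m : ℂ) * z₀ * γ m := by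
  -- Storing `g z₀` as the n-th parameter changes neither the nest nor any c'_m, ρ_m with m ≤ n, all
  -- of which use only indices below n.
  set δ := Function.update γ n (g z₀) with hδ
  have hδγ : ∀ k < n, δ k = γ k := fun k hk => Function.update_of_ne hk.ne _ _
  have hδn : δ n = g z₀ := Function.update_self _ _ _
  have key : ∀ m, 1 ≤ m → m ≤ n →
      iteratedDeriv m h z₀ = center' z₀ γ m + (rho z₀ γ m : ℂ) * z₀ * δ m := by
    intro m hm hmn
    rw [iteratedDeriv_mul_nest_of_apply_eq (γ := δ) hz₀ (by rwa [hδγ 0 hn]) hg hn hδn.symm hm hmn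
      (hh.trans (Filter.Eventually.of_forall fun z => ?_)),
      center'_congr hm fun k hk => hδγ k (by omega), rho_congr fun k hk => hδγ k (by omega)]
    dsimp only
    rw [nest_congr rfl n γ δ fun k hk => (hδγ k hk).symm]
  refine ⟨by rw [key n hn le_rfl, hδn], fun m hm hmn => ?_⟩
  rw [key m hm hmn.le, hδγ m hmn]

/-! ### The Schur class and the Schur algorithm -/

theorem norm_one_add_conj_mul_sq_sub (a z : ℂ) :
    ‖1 + conj a * z‖ ^ 2 - ‖z + a‖ ^ 2 = (1 - ‖a‖ ^ 2) * (1 - ‖z‖ ^ 2) := by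
  simp only [Complex.sq_norm, Complex.normSq_apply, Complex.add_re, Complex.add_im,
    Complex.mul_re, Complex.mul_im, Complex.conj_re, Complex.conj_im, Complex.one_re,
    Complex.one_im]
  ring

theorem norm_diskT_le_one {a z : ℂ} (ha : ‖a‖ < 1) (hz : ‖z‖ ≤ 1) : ‖diskT a z‖ ≤ 1 := by
  rw [diskT, norm_div, div_le_one (norm_pos_iff.2 (one_add_conj_mul_ne_zero ha hz))]
  refine (sq_le_sq₀ (norm_nonneg _) (norm_nonneg _)).1 ?_
  have h1 : 0 ≤ 1 - ‖a‖ ^ 2 := by nlinarith [norm_nonneg a]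
  have h2 : 0 ≤ 1 - ‖z‖ ^ 2 := by nlinarith [norm_nonneg z]
  linarith [norm_one_add_conj_mul_sq_sub a z, mul_nonneg h1 h2]

theorem norm_diskT_lt_one {a z : ℂ} (ha : ‖a‖ < 1) (hz : ‖z‖ < 1) : ‖diskT a z‖ < 1 := by
  rw [diskT, norm_div, div_lt_one (norm_pos_iff.2 (one_add_conj_mul_ne_zero ha hz.le))]
  refine (sq_lt_sq₀ (norm_nonneg _) (norm_nonneg _)).1 ?_
  have h1 : 0 < 1 - ‖a‖ ^ 2 := by nlinarith [norm_nonneg a]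
  have h2 : 0 < 1 - ‖z‖ ^ 2 := by nlinarith [norm_nonneg z]
  linarith [norm_one_add_conj_mul_sq_sub a z, mul_pos h1 h2]

theorem norm_one_sub_conj_mul_le {a z : ℂ} (ha : ‖a‖ < 1) (hz : 1 ≤ ‖z‖) :
    ‖1 - conj a * z‖ ≤ ‖z - a‖ := by
  refine (sq_le_sq₀ (norm_nonneg _) (norm_nonneg _)).1 ?_
  have h1 : 0 ≤ 1 - ‖a‖ ^ 2 := by nlinarith [norm_nonneg a]
  have h2 : 0 ≤ ‖z‖ ^ 2 - 1 := by nlinarith [norm_nonneg z]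
  have h := norm_one_add_conj_mul_sq_sub (-a) z
  rw [map_neg, neg_mul, ← sub_eq_add_neg, ← sub_eq_add_neg, norm_neg] at h
  linarith [mul_nonneg h1 h2]

theorem differentiableAt_diskT {a z : ℂ} (ha : ‖a‖ < 1) (hz : ‖z‖ ≤ 1) :
    DifferentiableAt ℂ (diskT a) z :=
  (analyticAt_diskT (one_add_conj_mul_ne_zero ha hz)).differentiableAt

theorem mem_schurClass_iff {f : ℂ → ℂ} :
    f ∈ SchurClass ↔ (∀ z, ‖z‖ < 1 → DifferentiableAt ℂ f z) ∧ ∀ z, ‖z‖ < 1 → ‖f z‖ ≤ 1 := by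
  refine and_congr ⟨fun h z hz => ?_, fun h z hz => ?_⟩ ⟨fun h z hz => ?_, fun h z hz => ?_⟩
  · exact h.differentiableAt (Metric.isOpen_ball.mem_nhds (mem_ball_zero_iff.2 hz))
  · exact (h z (mem_ball_zero_iff.1 hz)).differentiableWithinAt
  · exact mem_closedBall_zero_iff.1 (h (mem_ball_zero_iff.2 hz))
  · exact mem_closedBall_zero_iff.2 (h z (mem_ball_zero_iff.1 hz))

theorem analyticAt_of_mem_schurClass {f : ℂ → ℂ} (hf : f ∈ SchurClass) {z : ℂ} (hz : ‖z‖ < 1) :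
    AnalyticAt ℂ f z :=
  hf.1.analyticAt (Metric.isOpen_ball.mem_nhds (mem_ball_zero_iff.2 hz))

theorem const_mem_schurClass {c : ℂ} (hc : ‖c‖ ≤ 1) : (fun _ => c) ∈ SchurClass :=
  mem_schurClass_iff.2 ⟨fun _ _ => differentiableAt_const c, fun _ _ => hc⟩

theorem diskT_comp_mem_schurClass {a : ℂ} (ha : ‖a‖ < 1) {f : ℂ → ℂ} (hf : f ∈ SchurClass) :
    (fun z => diskT a (f z)) ∈ SchurClass := by
  rw [mem_schurClass_iff] at hf ⊢
  exact ⟨fun z hz =>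
      DifferentiableAt.fun_comp' z (differentiableAt_diskT ha (hf.2 z hz)) (hf.1 z hz),
    fun z hz => norm_diskT_le_one ha (hf.2 z hz)⟩

theorem diskT_mul_mem_schurClass {a : ℂ} (ha : ‖a‖ < 1) {f : ℂ → ℂ} (hf : f ∈ SchurClass) :
    (fun z => diskT a z * f z) ∈ SchurClass := by
  rw [mem_schurClass_iff] at hf ⊢
  refine ⟨fun z hz => (differentiableAt_diskT ha hz.le).fun_mul (hf.1 z hz), fun z hz => ?_⟩
  rw [norm_mul]
  exact mul_le_one₀ (norm_diskT_le_one ha hz.le) (norm_nonneg _) (hf.2 z hz)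

theorem nest_mem_schurClass {z₀ : ℂ} (hz₀ : ‖z₀‖ < 1) {g : ℂ → ℂ} (hg : g ∈ SchurClass) (m : ℕ) :
    ∀ γ : ℕ → ℂ, (∀ k < m, ‖γ k‖ < 1) → nest z₀ m γ g ∈ SchurClass := by
  induction m with
  | zero => exact fun _ _ => hg
  | succ m ih =>
    intro γ h
    exact diskT_comp_mem_schurClass (h 0 (by omega)) (diskT_mul_mem_schurClass
      (by rwa [norm_neg]) (ih _ fun k hk => h (k + 1) (by omega)))

/-- One step of the Schur algorithm at the point `z₀`. -/
theorem exists_eq_diskT_mul {z₀ : ℂ} (hz₀ : ‖z₀‖ < 1) {f : ℂ → ℂ} (hf : f ∈ SchurClass)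
    (hfz₀ : ‖f z₀‖ < 1) :
    ∃ g ∈ SchurClass, ∀ z, ‖z‖ < 1 → f z = diskT (f z₀) (diskT (-z₀) z * g z) := by
  have hz₀' : ‖-z₀‖ < 1 := by rwa [norm_neg]
  have hfz₀' : ‖-f z₀‖ < 1 := by rwa [norm_neg]
  have hq := mem_schurClass_iff.1 (diskT_comp_mem_schurClass hfz₀' hf)
  -- Conjugating by automorphisms moves z₀ and f(z₀) to 0, so that the Schwarz lemma applies; the
  -- next Schur function is q(u)/u in the coordinate u = T_{-z₀}(z).
  set q : ℂ → ℂ := fun u => diskT (-f z₀) (f (diskT z₀ u)) with hqdef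
  have hq0 : q 0 = 0 := by simp [hqdef, diskT_zero, diskT_neg_self]
  have hqd : DifferentiableOn ℂ q (Metric.ball 0 1) := fun u hu =>
    have hu' := mem_ball_zero_iff.1 hu
    (DifferentiableAt.fun_comp' (g := fun z => diskT (-f z₀) (f z)) u
      (hq.1 _ (norm_diskT_lt_one hz₀ hu'))
      (differentiableAt_diskT hz₀ hu'.le)).differentiableWithinAt
  have hqm : Set.MapsTo q (Metric.ball 0 1) (Metric.closedBall (q 0) 1) := fun u hu => by
    rw [hq0, mem_closedBall_zero_iff]
    exact hq.2 _ (norm_diskT_lt_one hz₀ (mem_ball_zero_iff.1 hu))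
  have hs : dslope q 0 ∈ SchurClass := by
    refine ⟨(Complex.differentiableOn_dslope (Metric.ball_mem_nhds 0 one_pos)).2 hqd,
      fun u hu => ?_⟩
    simpa using Complex.norm_dslope_le_div_of_mapsTo_ball hqd hqm hu
  rw [mem_schurClass_iff] at hs
  refine ⟨fun z => dslope q 0 (diskT (-z₀) z), mem_schurClass_iff.2
    ⟨fun z hz => DifferentiableAt.fun_comp' z (hs.1 _ (norm_diskT_lt_one hz₀' hz))
      (differentiableAt_diskT hz₀' hz.le), fun z hz => hs.2 _ (norm_diskT_lt_one hz₀' hz)⟩,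
    fun z hz => ?_⟩
  have h1 := eq_add_mul_dslope q 0 (diskT (-z₀) z)
  rw [hq0, zero_add, sub_zero] at h1
  have h2 : diskT z₀ (diskT (-z₀) z) = z := by
    simpa using diskT_neg_diskT hz₀' hz.le
  rw [← h1, hqdef]
  simp only [h2]
  simpa using (diskT_neg_diskT hfz₀' ((mem_schurClass_iff.1 hf).2 z hz)).symm

theorem eq_of_norm_eq_one {z₀ : ℂ} (hz₀ : ‖z₀‖ < 1) {f : ℂ → ℂ} (hf : f ∈ SchurClass)
    (hfz₀ : ‖f z₀‖ = 1) {z : ℂ} (hz : ‖z‖ < 1) : f z = f z₀ :=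
  Complex.eqOn_of_isPreconnected_of_isMaxOn_norm (convex_ball (0 : ℂ) 1).isPreconnected
    Metric.isOpen_ball hf.1 (mem_ball_zero_iff.2 hz₀)
    (fun y hy => by
      simpa [hfz₀] using mem_closedBall_zero_iff.1 (hf.2 hy)) (mem_ball_zero_iff.2 hz)

/-- `nest` recurses from the outermost factor, whereas the Schur algorithm adds factors innermost.
-/
theorem nest_diskT_mul (z₀ z : ℂ) (g : ℂ → ℂ) (m : ℕ) :
    ∀ γ : ℕ → ℂ, nest z₀ m γ (fun z => diskT (γ m) (diskT (-z₀) z * g z)) z =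
      nest z₀ (m + 1) γ g z := by
  induction m with
  | zero => exact fun _ => rfl
  | succ m ih =>
    intro γ
    rw [nest, ih fun i => γ (i + 1)]
    rfl

theorem nest_zero_of_forall_eq_zero (z₀ z : ℂ) (m : ℕ) :
    ∀ γ : ℕ → ℂ, (∀ k < m, γ k = 0) → nest z₀ m γ (fun _ => 0) z = 0 := by
  induction m with
  | zero => exact fun _ _ => rfl
  | succ m ih =>
    intro γ h
    rw [nest, ih _ fun k hk => h (k + 1) (by omega), mul_zero, diskT_zero, h 0 (by omega)]

/-- Zero parameters collapse because T_a(0) = a, even for |a| = 1. The degenerate solution thus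
becomes a nest of full depth, to which the derivative formula applies. -/
theorem nest_zero_eq_nest_const (z₀ z : ℂ) {n : ℕ} (j : ℕ) :
    ∀ γ : ℕ → ℂ, (∀ k, j < k → k < j + 1 + n → γ k = 0) →
      nest z₀ (j + 1 + n) γ (fun _ => 0) z = nest z₀ j γ (fun _ => γ j) z := by
  induction j with
  | zero =>
    intro γ h
    rw [show 0 + 1 + n = n + 1 by omega]
    simp only [nest]
    rw [nest_zero_of_forall_eq_zero _ _ n
      (fun i => γ (i + 1)) fun k hk => h (k + 1) (by omega) (by omega), mul_zero, diskT_zero]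
  | succ j ih =>
    intro γ h
    rw [show j + 1 + 1 + n = j + 1 + n + 1 by omega, nest,
      ih _ fun k hk hk' => h (k + 1) (by omega) (by omega), nest]

theorem rho_pos {z₀ : ℂ} {γ : ℕ → ℂ} (hz₀ : ‖z₀‖ < 1) {m : ℕ} (h : ∀ k < m, ‖γ k‖ < 1) :
    0 < rho z₀ γ m := by
  have h1 : ∀ a : ℂ, ‖a‖ < 1 → 0 < 1 - ‖a‖ ^ 2 := fun a ha => by nlinarith [norm_nonneg a]
  exact div_pos (mul_pos (by positivity)
    (Finset.prod_pos fun k hk => h1 _ (h k (Finset.mem_range.1 hk)))) (pow_pos (h1 _ hz₀) _)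

theorem eventuallyEq_of_forall_norm_lt_one {f g : ℂ → ℂ} (h : ∀ z, ‖z‖ < 1 → f z = g z) {z₀ : ℂ}
    (hz₀ : ‖z₀‖ < 1) : f =ᶠ[nhds z₀] g := by
  filter_upwards [Metric.isOpen_ball.mem_nhds (mem_ball_zero_iff.2 hz₀)] with z hz
  exact h z (mem_ball_zero_iff.1 hz)

theorem exists_mem_schurClass_eq_mul {h : ℂ → ℂ} (hh : h ∈ selfMapsFixingZero) :
    ∃ f ∈ SchurClass, ∀ z, ‖z‖ < 1 → h z = z * f z := by
  obtain ⟨hd, hm, h0⟩ := hh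
  refine ⟨dslope h 0, ⟨(Complex.differentiableOn_dslope (Metric.ball_mem_nhds 0 one_pos)).2 hd,
    fun u hu => ?_⟩, fun z _ => ?_⟩
  · have := Complex.norm_dslope_le_div_of_mapsTo_ball hd
      (by rw [h0]; exact hm.mono_right Metric.ball_subset_closedBall) hu
    simpa using this
  · simpa [h0] using eq_add_mul_dslope h 0 z

theorem mul_mem_selfMapsFixingZero {f : ℂ → ℂ} (hf : f ∈ SchurClass) :
    (fun z => z * f z) ∈ selfMapsFixingZero := by
  refine ⟨differentiableOn_id.fun_mul hf.1, fun z hz => ?_, zero_mul _⟩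
  have h1 := mem_ball_zero_iff.1 hz
  have h2 := mem_closedBall_zero_iff.1 (hf.2 hz)
  rw [mem_ball_zero_iff, norm_mul]
  nlinarith [norm_nonneg z, norm_nonneg (f z)]

/-! ### Finite Blaschke products -/

theorem isBlaschkeProduct_of_norm_eq_one {d : ℕ} {c : ℂ} (hc : ‖c‖ = 1) {a : Fin d → ℂ}
    (ha : ∀ i, ‖a i‖ < 1) {B : ℂ → ℂ}
    (hB : ∀ z, ‖z‖ < 1 → B z = c * ∏ i, (z - a i) / (1 - conj (a i) * z)) :
    IsBlaschkeProduct d B := by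
  refine ⟨c.arg, a, ha, fun z hz => ?_⟩
  have := Complex.norm_mul_exp_arg_mul_I c
  rw [hc, Complex.ofReal_one, one_mul] at this
  rw [this, hB z hz]

theorem IsBlaschkeProduct.diskT_mul {d : ℕ} {B : ℂ → ℂ} (hB : IsBlaschkeProduct d B) {z₀ : ℂ}
    (hz₀ : ‖z₀‖ < 1) : IsBlaschkeProduct (d + 1) (fun z => diskT (-z₀) z * B z) := by
  obtain ⟨θ, a, ha, h⟩ := hB
  refine ⟨θ, Fin.cons z₀ a, Fin.cases hz₀ ha, fun z hz => ?_⟩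
  dsimp only
  rw [Fin.prod_univ_succ, h z hz]
  simp only [Fin.cons_zero, Fin.cons_succ, diskT, map_neg, neg_mul, ← sub_eq_add_neg]
  ring

theorem exists_fin_map_eq {α : Type*} (s : Multiset α) {d : ℕ} (hs : s.card = d) :
    ∃ b : Fin d → α, Finset.univ.val.map b = s := by
  subst hs
  refine ⟨fun i => s.toList.get (i.cast s.length_toList.symm), ?_⟩
  rw [Fin.univ_val_map, ← List.ofFn_congr s.length_toList, List.ofFn_get, Multiset.coe_toList]

open Polynomial in
/-- For `|c| = 1` and `|α| < 1`, the polynomial `c ∏ (X - a i) + α ∏ (1 - conj (a i) X)` has degree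
`d` and all its zeros lie in the unit disk. -/
theorem exists_prod_eq_add_prod {d : ℕ} {a : Fin d → ℂ} (ha : ∀ i, ‖a i‖ < 1) {c α : ℂ}
    (hc : ‖c‖ = 1) (hα : ‖α‖ < 1) :
    ∃ b : Fin d → ℂ, (∀ i, ‖b i‖ < 1) ∧ c + α * ∏ i, (-conj (a i)) ≠ 0 ∧
      ∀ z, c * ∏ i, (z - a i) + α * ∏ i, (1 - conj (a i) * z) =
        (c + α * ∏ i, (-conj (a i))) * ∏ i, (z - b i) := by
  set P : ℂ[X] := ∏ i, (X - C (a i)) with hP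
  set Q : ℂ[X] := ∏ i, (C (-conj (a i)) * X + C 1) with hQ
  set N : ℂ[X] := C c * P + C α * Q with hN
  have hPe : ∀ z, P.eval z = ∏ i, (z - a i) := fun z => by simp [hP, eval_prod]
  have hQe : ∀ z, Q.eval z = ∏ i, (1 - conj (a i) * z) := fun z => by
    rw [hQ, eval_prod]
    refine Finset.prod_congr rfl fun i _ => ?_
    simp
    ring
  have hNe : ∀ z, N.eval z = c * ∏ i, (z - a i) + α * ∏ i, (1 - conj (a i) * z) := fun z => by
    simp [hN, hPe, hQe]
  have hPn : P.natDegree ≤ d := by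
    simp [hP]
  have hQn : Q.natDegree ≤ d := by
    refine (natDegree_prod_le _ _).trans ((Finset.sum_le_card_nsmul _ _ 1 fun i _ => ?_).trans ?_)
    · exact natDegree_linear_le
    · simp
  have hPc : P.coeff d = 1 := by
    simpa using coeff_prod_of_natDegree_le (s := Finset.univ) (fun i => X - C (a i)) 1
      fun i _ => natDegree_X_sub_C_le _
  have hQc : Q.coeff d = ∏ i, (-conj (a i)) := by
    have := coeff_prod_of_natDegree_le (s := Finset.univ)
      (fun i => C (-conj (a i)) * X + C 1) 1 fun i _ => natDegree_linear_le
    rw [Finset.card_univ, Fintype.card_fin, mul_one] at this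
    rw [hQ, this]
    refine Finset.prod_congr rfl fun i _ => ?_
    rw [coeff_add, coeff_C_mul, coeff_X_one, coeff_C_succ, mul_one, add_zero]
  have hNc : N.coeff d = c + α * ∏ i, (-conj (a i)) := by
    simp only [hN, coeff_add, coeff_C_mul, hPc, hQc, mul_one]
  have hne : c + α * ∏ i, (-conj (a i)) ≠ 0 := by
    intro h
    have h1 : ‖α * ∏ i, (-conj (a i))‖ = 1 := by
      rw [← neg_eq_of_add_eq_zero_right h, norm_neg, hc]
    rw [norm_mul, norm_prod] at h1
    have h2 : ∏ i, ‖-conj (a i)‖ ≤ 1 :=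
      Finset.prod_le_one (fun _ _ => norm_nonneg _) fun i _ => by
        rw [norm_neg, RCLike.norm_conj]
        exact (ha i).le
    nlinarith [norm_nonneg α]
  have hNn : N.natDegree = d := by
    refine natDegree_eq_of_le_of_coeff_ne_zero ?_ (by rwa [hNc])
    exact (natDegree_add_le _ _).trans (max_le ((natDegree_C_mul_le _ _).trans hPn)
      ((natDegree_C_mul_le _ _).trans hQn))
  have hNlc : N.leadingCoeff = c + α * ∏ i, (-conj (a i)) := by
    rw [leadingCoeff, hNn, hNc]
  have hsp := IsAlgClosed.splits N
  have hN0 : N ≠ 0 := fun h => hne (by rw [← hNlc, h, leadingCoeff_zero])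
  obtain ⟨b, hb⟩ := exists_fin_map_eq N.roots (hsp.natDegree_eq_card_roots.symm.trans hNn)
  refine ⟨b, fun i => ?_, hne, fun z => ?_⟩
  · have hbi : N.eval (b i) = 0 := by
      refine (mem_roots hN0).1 ?_
      rw [← hb]
      exact Multiset.mem_map_of_mem b (Finset.mem_univ i)
    -- At a zero outside the open disk each |1 - conj a z| ≤ |z - a|, and the product of the |z - a|
    -- is nonzero; the two summands could cancel only if |α| ≥ 1.
    by_contra! h1
    rw [hNe] at hbi
    have h2 : ‖∏ k, (b i - a k)‖ = ‖α‖ * ‖∏ k, (1 - conj (a k) * b i)‖ := by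
      rw [← norm_mul, ← neg_eq_of_add_eq_zero_right hbi, norm_neg, norm_mul, hc, one_mul]
    have h3 : ‖∏ k, (1 - conj (a k) * b i)‖ ≤ ‖∏ k, (b i - a k)‖ := by
      rw [norm_prod, norm_prod]
      exact Finset.prod_le_prod (fun _ _ => norm_nonneg _)
        fun k _ => norm_one_sub_conj_mul_le (ha k) h1
    have h4 : 0 < ‖∏ k, (b i - a k)‖ := by
      refine norm_pos_iff.2 (Finset.prod_ne_zero_iff.2 fun k _ h => ?_)
      rw [sub_eq_zero.1 h] at h1
      exact absurd (ha k) (not_lt.2 h1)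
    nlinarith [norm_nonneg α]
  · rw [← hNe]
    conv_lhs => rw [hsp.eq_prod_roots, hNlc, ← hb]
    rw [eval_mul, eval_C, Multiset.map_map, eval_multiset_prod, Multiset.map_map]
    simp [List.prod_ofFn]

theorem prod_reflect {d : ℕ} (a : Fin d → ℂ) {z : ℂ} (hz : z ≠ 0) :
    z ^ d * conj (∏ i, ((conj z)⁻¹ - a i)) = ∏ i, (1 - conj (a i) * z) := by
  rw [← Fin.prod_const, map_prod, ← Finset.prod_mul_distrib]
  refine Finset.prod_congr rfl fun i _ => ?_
  rw [map_sub, map_inv₀, Complex.conj_conj]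
  field_simp

theorem prod_reflect' {d : ℕ} (a : Fin d → ℂ) {z : ℂ} (hz : z ≠ 0) :
    z ^ d * conj (∏ i, (1 - conj (a i) * (conj z)⁻¹)) = ∏ i, (z - a i) := by
  rw [← Fin.prod_const, map_prod, ← Finset.prod_mul_distrib]
  refine Finset.prod_congr rfl fun i _ => ?_
  rw [map_sub, map_mul, map_inv₀, Complex.conj_conj, Complex.conj_conj, map_one]
  field_simp

/-- For B = cP/Q, T_α ∘ B = (cP + αQ) / (Q + conj α cP). The denominator is c times the reflection
of the numerator under z ↦ 1 / conj z, so factoring the numerator factors both. -/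
theorem IsBlaschkeProduct.diskT_comp {d : ℕ} {B : ℂ → ℂ} (hB : IsBlaschkeProduct d B) {α : ℂ}
    (hα : ‖α‖ < 1) : IsBlaschkeProduct d (fun z => diskT α (B z)) := by
  obtain ⟨θ, a, ha, h⟩ := hB
  have hc := Complex.norm_exp_ofReal_mul_I θ
  set c := Complex.exp (θ * Complex.I)
  obtain ⟨b, hb, hne, hN⟩ := exists_prod_eq_add_prod ha hc hα
  set ℓ := c + α * ∏ i, (-conj (a i)) with hℓ
  have hcc : c * conj c = 1 := by rw [Complex.mul_conj', hc]; norm_num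
  have hM : ∀ z, ∏ i, (1 - conj (a i) * z) + conj α * c * ∏ i, (z - a i) =
      c * conj ℓ * ∏ i, (1 - conj (b i) * z) := by
    intro z
    -- The reflection is undefined at the origin, where the identity only compares constant terms.
    by_cases hz : z = 0
    · simp only [hz, mul_zero, sub_zero, Finset.prod_const_one, zero_sub, hℓ, map_add, map_mul,
        map_prod, map_neg, Complex.conj_conj]
      linear_combination -hcc
    · have h1 := congrArg (fun x => z ^ d * conj x) (hN (conj z)⁻¹)
      simp only [map_add, map_mul _ c, map_mul _ α, map_mul _ ℓ, mul_add] at h1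
      rw [mul_left_comm, prod_reflect a hz, mul_left_comm, prod_reflect' a hz, mul_left_comm,
        prod_reflect b hz] at h1
      linear_combination c * h1 - (∏ i, (1 - conj (a i) * z)) * hcc
  refine isBlaschkeProduct_of_norm_eq_one (c := ℓ / (c * conj ℓ)) ?_ hb fun z hz => ?_
  · rw [norm_div, norm_mul, hc, one_mul, RCLike.norm_conj, div_self (norm_ne_zero_iff.2 hne)]
  · have hden : ∀ x : ℂ, ‖x‖ < 1 → 1 - conj x * z ≠ 0 := fun x hx => by
      simpa [sub_eq_add_neg] using one_add_conj_mul_ne_zero (a := -x) (by rwa [norm_neg]) hz.le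
    have hQ : ∏ i, (1 - conj (a i) * z) ≠ 0 := Finset.prod_ne_zero_iff.2 fun i _ => hden _ (ha i)
    rw [h z hz, Finset.prod_div_distrib, Finset.prod_div_distrib, diskT, ← mul_div_assoc,
      ← mul_div_assoc, div_add' _ _ _ hQ, add_div' _ _ _ hQ, div_div_div_cancel_right₀ hQ, hN,
      one_mul, ← mul_assoc, hM, mul_div_mul_comm]

theorem isBlaschkeProduct_nest {z₀ : ℂ} (hz₀ : ‖z₀‖ < 1) {c : ℂ} (hc : ‖c‖ = 1) (m : ℕ) :
    ∀ γ : ℕ → ℂ, (∀ k < m, ‖γ k‖ < 1) → IsBlaschkeProduct m (nest z₀ m γ fun _ => c) := by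
  induction m with
  | zero =>
    exact fun γ _ => isBlaschkeProduct_of_norm_eq_one hc (a := Fin.elim0) (fun i => i.elim0)
      fun z _ => by simp [nest]
  | succ m ih =>
    intro γ h
    exact ((ih _ fun k hk => h (k + 1) (by omega)).diskT_mul hz₀).diskT_comp (h 0 (by omega))

/-! ### Interpolation data determine the Schur parameters; the theorem -/

/-- The first `k` Schur parameters of `z ↦ h z / z` at `z₀`, for `h` in the interpolation class, are
`γ 0, …, γ (k - 1)`. -/
theorem exists_eq_mul_nest {n : ℕ} {z₀ : ℂ} {w γ : ℕ → ℂ} (hz₀ : ‖z₀‖ < 1) (hz₀' : z₀ ≠ 0)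
    (hγ₀ : γ 0 = w 0 / z₀)
    (hw : ∀ k, 1 ≤ k → k < n → w k = center' z₀ γ k + (rho z₀ γ k : ℂ) * z₀ * γ k)
    {h : ℂ → ℂ} (hh : h ∈ interpClass n z₀ w) (k : ℕ) (hk : k ≤ n) (hγ : ∀ i < k, ‖γ i‖ < 1) :
    ∃ g ∈ SchurClass, (∀ z, ‖z‖ < 1 → h z = z * nest z₀ k γ g z) ∧ (k < n → g z₀ = γ k) := by
  induction k with
  | zero =>
    obtain ⟨f, hf, hhf⟩ := exists_mem_schurClass_eq_mul hh.1
    refine ⟨f, hf, hhf, fun h0 => ?_⟩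
    have := hh.2 0 h0
    rw [iteratedDeriv_zero, hhf z₀ hz₀] at this
    rw [hγ₀, ← this, mul_div_cancel_left₀ _ hz₀']
  | succ k ih =>
    obtain ⟨g, hg, hhg, hgk⟩ := ih (by omega) fun i hi => hγ i (by omega)
    have hgk := hgk (by omega)
    obtain ⟨g', hg', hgg'⟩ := exists_eq_diskT_mul hz₀ hg (by rw [hgk]; exact hγ k (by omega))
    rw [hgk] at hgg'
    have hhg' : ∀ z, ‖z‖ < 1 → h z = z * nest z₀ (k + 1) γ g' z := fun z hz => by
      rw [hhg z hz, ← nest_diskT_mul, nest_congr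
        (g' := fun z => diskT (γ k) (diskT (-z₀) z * g' z)) (hgg' z hz) k γ γ fun _ _ => rfl]
    refine ⟨g', hg', hhg', fun hkn => ?_⟩
    -- The prescribed derivative and the computed one differ only in `γ (k + 1)` against `g' z₀`,
    -- with the common nonzero factor ρ z₀.
    have h1 := (iteratedDeriv_mul_nest hz₀ (hγ 0 (by omega)) (analyticAt_of_mem_schurClass hg' hz₀)
      (Nat.le_add_left 1 k) (eventuallyEq_of_forall_norm_lt_one hhg' hz₀)).1
    rw [hh.2 _ hkn, hw _ (by omega) hkn] at h1
    have hρ : (rho z₀ γ (k + 1) : ℂ) ≠ 0 := Complex.ofReal_ne_zero.2 (rho_pos hz₀ hγ).ne'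
    exact (mul_left_cancel₀ (mul_ne_zero hρ hz₀') (add_left_cancel h1)).symm

end Dieudonne

open Dieudonne in
theorem mainTheorem3 (n : ℕ) (hn : 1 ≤ n) (z₀ : ℂ) (w γ : ℕ → ℂ)
    (hz₀ : ‖z₀‖ < 1) (hw₀ : ‖w 0‖ < 1) (hlt : ‖w 0‖ < ‖z₀‖)
    (hγ₀ : γ 0 = w 0 / z₀)
    (hγ : ∀ k, 1 ≤ k → k < n → ‖γ k‖ ≤ 1)
    (hw : ∀ k, 1 ≤ k → k < n →
      w k = Dieudonne.center' z₀ γ k + (Dieudonne.rho' z₀ γ k : ℂ) * z₀ * γ k / (‖z₀‖ : ℂ)) :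
    (∀ j, 1 ≤ j → j < n → (∀ k, 1 ≤ k → k < j → ‖γ k‖ < 1) → ‖γ j‖ = 1 →
      (∀ k, j < k → k < n → γ k = 0) →
        Dieudonne.IsBlaschkeProduct j (Dieudonne.nest z₀ j γ (fun _ => γ j)) ∧
        ∀ h ∈ Dieudonne.interpClass n z₀ w,
          iteratedDeriv n h z₀ = Dieudonne.center' z₀ γ n ∧
          ∀ z : ℂ, ‖z‖ < 1 → h z = z * Dieudonne.nest z₀ j γ (fun _ => γ j) z) ∧
    ((∀ k, 1 ≤ k → k < n → ‖γ k‖ < 1) →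
      (fun h : ℂ → ℂ => iteratedDeriv n h z₀) '' Dieudonne.interpClass n z₀ w =
        Metric.closedBall (Dieudonne.center' z₀ γ n) (Dieudonne.rho' z₀ γ n) ∧
      (fun ε : ℂ => iteratedDeriv n (Dieudonne.extremal n z₀ γ ε) z₀) ''
          Metric.closedBall 0 1 =
        Metric.closedBall (Dieudonne.center' z₀ γ n) (Dieudonne.rho' z₀ γ n) ∧
      (∀ ε : ℂ, ‖ε‖ ≤ 1 → Dieudonne.extremal n z₀ γ ε ∈ Dieudonne.interpClass n z₀ w) ∧
      ∀ h ∈ Dieudonne.interpClass n z₀ w,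
        (∃ g ∈ Dieudonne.SchurClass, ∀ z : ℂ, ‖z‖ < 1 → h z = z * Dieudonne.nest z₀ n γ g z) ∧
        (iteratedDeriv n h z₀ ∈
            Metric.sphere (Dieudonne.center' z₀ γ n) (Dieudonne.rho' z₀ γ n) ↔
          ∃ ε : ℂ, ‖ε‖ = 1 ∧
            ∀ z : ℂ, ‖z‖ < 1 → h z = Dieudonne.extremal n z₀ γ ε z)) := by
  have hz₀pos : 0 < ‖z₀‖ := (norm_nonneg _).trans_lt hlt
  have hz₀' : z₀ ≠ 0 := norm_pos_iff.1 hz₀pos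
  have hγ₀' : ‖γ 0‖ < 1 := by rwa [hγ₀, norm_div, div_lt_one hz₀pos]
  have hw' : ∀ k, 1 ≤ k → k < n → w k = center' z₀ γ k + (rho z₀ γ k : ℂ) * z₀ * γ k := by
    intro k hk hkn
    have : (‖z₀‖ : ℂ) ≠ 0 := Complex.ofReal_ne_zero.2 hz₀pos.ne'
    rw [hw k hk hkn, rho']
    push_cast
    field_simp
  have hlt_of : ∀ j, (∀ k, 1 ≤ k → k < j → ‖γ k‖ < 1) → ∀ k < j, ‖γ k‖ < 1 := by
    intro j hj k hk
    rcases Nat.eq_zero_or_pos k with rfl | h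
    · exact hγ₀'
    · exact hj k h hk
  refine ⟨fun j hj hjn hγj hj1 hγ0 => ⟨isBlaschkeProduct_nest hz₀ hj1 j γ (hlt_of j hγj),
    fun h hh => ?_⟩, fun hγ1 => ?_⟩
  · obtain ⟨g, hg, hhg, hgj⟩ :=
      exists_eq_mul_nest hz₀ hz₀' hγ₀ hw' hh j hjn.le (hlt_of j hγj)
    have hgj := hgj hjn
    have hhj : ∀ z, ‖z‖ < 1 → h z = z * nest z₀ j γ (fun _ => γ j) z := fun z hz => by
      rw [hhg z hz, nest_congr (g' := fun _ => γ j) _ j γ γ fun _ _ => rfl]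
      rw [eq_of_norm_eq_one hz₀ hg (by rw [hgj, hj1]) hz, hgj]
    refine ⟨?_, hhj⟩
    -- Read as a nest of depth n with inner function 0, `h` has n-th derivative c'_n. The derivative
    -- formula asks only |γ₀| < 1, so the unimodular γ_j is allowed.
    obtain ⟨d, rfl⟩ := Nat.exists_eq_add_of_le (Nat.succ_le_of_lt hjn)
    have h0 : ∀ z, ‖z‖ < 1 → h z = z * nest z₀ (j + 1 + d) γ (fun _ => 0) z := fun z hz => by
      rw [hhj z hz, nest_zero_eq_nest_const z₀ z j γ hγ0]
    rw [(iteratedDeriv_mul_nest hz₀ hγ₀' analyticAt_const hn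
      (eventuallyEq_of_forall_norm_lt_one h0 hz₀)).1, mul_zero, add_zero]
  · have hγlt := hlt_of n hγ1
    have hρ := rho_pos hz₀ hγlt
    have hρ' : 0 < rho' z₀ γ n := mul_pos hz₀pos hρ
    have hsurj : ∀ y ∈ Metric.closedBall (center' z₀ γ n) (rho' z₀ γ n), ∃ ε : ℂ, ‖ε‖ ≤ 1 ∧
        center' z₀ γ n + (rho z₀ γ n : ℂ) * z₀ * ε = y := by
      intro y hy
      have hne : (rho z₀ γ n : ℂ) * z₀ ≠ 0 := mul_ne_zero (Complex.ofReal_ne_zero.2 hρ.ne') hz₀'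
      refine ⟨(y - center' z₀ γ n) / ((rho z₀ γ n : ℂ) * z₀), ?_, ?_⟩
      · rw [norm_div, norm_mul, Complex.norm_real, Real.norm_of_nonneg hρ.le, mul_comm,
          div_le_one (mul_pos hz₀pos hρ)]
        exact mem_closedBall_iff_norm.1 hy
      · rw [mul_div_cancel₀ _ hne, add_sub_cancel]
    have hnorm : ∀ ε : ℂ, ‖center' z₀ γ n + (rho z₀ γ n : ℂ) * z₀ * ε - center' z₀ γ n‖ =
        rho' z₀ γ n * ‖ε‖ := by
      intro ε
      rw [add_sub_cancel_left, norm_mul, norm_mul, Complex.norm_real, Real.norm_of_nonneg hρ.le,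
        rho', mul_comm ‖z₀‖]
    have hmem : ∀ ε : ℂ, ‖ε‖ ≤ 1 →
        center' z₀ γ n + (rho z₀ γ n : ℂ) * z₀ * ε ∈
          Metric.closedBall (center' z₀ γ n) (rho' z₀ γ n) := by
      intro ε hε
      rw [mem_closedBall_iff_norm, hnorm]
      exact mul_le_of_le_one_right hρ'.le hε
    have hext : ∀ ε, iteratedDeriv n (extremal n z₀ γ ε) z₀ =
        center' z₀ γ n + (rho z₀ γ n : ℂ) * z₀ * ε := fun ε =>
      (iteratedDeriv_mul_nest (h := extremal n z₀ γ ε) hz₀ hγ₀' (g := fun _ => ε) analyticAt_const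
        hn Filter.EventuallyEq.rfl).1
    have hextmem : ∀ ε : ℂ, ‖ε‖ ≤ 1 → extremal n z₀ γ ε ∈ interpClass n z₀ w := by
      intro ε hε
      refine ⟨mul_mem_selfMapsFixingZero
        (nest_mem_schurClass hz₀ (const_mem_schurClass hε) n γ hγlt), fun k hk => ?_⟩
      rcases Nat.eq_zero_or_pos k with rfl | hk0
      · obtain ⟨N, rfl⟩ := Nat.exists_eq_add_of_le' hn
        rw [iteratedDeriv_zero, extremal, nest_self, hγ₀, mul_div_cancel₀ _ hz₀']
      · rw [hw' k hk0 hk]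
        exact (iteratedDeriv_mul_nest (h := extremal n z₀ γ ε) hz₀ hγ₀' (g := fun _ => ε)
          analyticAt_const hn Filter.EventuallyEq.rfl).2 k hk0 hk
    have hrep : ∀ h ∈ interpClass n z₀ w, ∃ g ∈ SchurClass,
        (∀ z, ‖z‖ < 1 → h z = z * nest z₀ n γ g z) ∧
          iteratedDeriv n h z₀ = center' z₀ γ n + (rho z₀ γ n : ℂ) * z₀ * g z₀ := by
      intro h hh
      obtain ⟨g, hg, hhg, -⟩ := exists_eq_mul_nest hz₀ hz₀' hγ₀ hw' hh n le_rfl hγlt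
      exact ⟨g, hg, hhg, (iteratedDeriv_mul_nest hz₀ hγ₀' (analyticAt_of_mem_schurClass hg hz₀) hn
        (eventuallyEq_of_forall_norm_lt_one hhg hz₀)).1⟩
    refine ⟨Set.Subset.antisymm ?_ fun y hy => ?_, Set.Subset.antisymm ?_ fun y hy => ?_, hextmem,
      fun h hh => ?_⟩
    · rintro _ ⟨h, hh, rfl⟩
      obtain ⟨g, hg, -, hgn⟩ := hrep h hh
      dsimp only
      rw [hgn]
      exact hmem _ ((mem_schurClass_iff.1 hg).2 z₀ hz₀)
    · obtain ⟨ε, hε, rfl⟩ := hsurj y hy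
      exact ⟨_, hextmem ε hε, hext ε⟩
    · rintro _ ⟨ε, hε, rfl⟩
      dsimp only
      rw [hext]
      exact hmem ε (mem_closedBall_zero_iff.1 hε)
    · obtain ⟨ε, hε, rfl⟩ := hsurj y hy
      exact ⟨ε, mem_closedBall_zero_iff.2 hε, hext ε⟩
    · obtain ⟨g, hg, hhg, hgn⟩ := hrep h hh
      refine ⟨⟨g, hg, hhg⟩, fun hs => ?_, ?_⟩
      -- The distance to the center is ρ'_n |g(z₀)|, so a boundary value forces |g(z₀)| = 1 and `g`
      -- is constant on the disk.
      · rw [mem_sphere_iff_norm, hgn, hnorm, mul_eq_left₀ hρ'.ne'] at hs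
        refine ⟨g z₀, hs, fun z hz => ?_⟩
        rw [hhg z hz, extremal,
          nest_congr (g' := fun _ => g z₀) (eq_of_norm_eq_one hz₀ hg hs hz) n γ γ fun _ _ => rfl]
      · rintro ⟨ε, hε, hhε⟩
        rw [mem_sphere_iff_norm,
          (eventuallyEq_of_forall_norm_lt_one hhε hz₀).iteratedDeriv_eq, hext, hnorm, hε, mul_one]
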